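/- For $N\ge 1$, an $N$ complex Wigner matrix (a matrix of the Gaussian Unitary Ensemble $GUE_N$) is a random matrix $X$ with values in the $N\times N$ complex Hermitian matrices such that the real random variables $X_{i,i}$ ($1\le i\le N$), $\sqrt2\,\mathrm{Re}(X_{i,j})$ and $\sqrt2\,\mathrm{Im}(X_{i,j})$ ($1\le i<j\le N$) are independent with the standard Gaussian law $\mathcal N(0,1)$. For a Hermitian matrix $A$, let $\lambda_{\max}(A)$ and $\lambda_{\min}(A)$ denote its largest and its smallest eigenvalue. **Theorem.** Let $(M_N)_{N\ge1}$ be a sequence of random matrices, defined on a common probability space, such that for every $N\ge1$ the matrix $M_N$ is an $N$ complex Wigner matrix (no assumption is made on the joint law of the matrices for different $N$). Then, almost surely, $$\lim_{N\to+\infty}\lambda_{\max}\left(\frac{M_N}{\sqrt N}\right)=2\qquad\text{and}\qquad\lim_{N\to+\infty}\lambda_{\min}\left(\frac{M_N}{\sqrt N}\right)=-2.$$ -/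

import Mathlib

open MeasureTheory ProbabilityTheory Filter Topology

noncomputable section

/-- The index set of the pairs `(i, j)` with `i < j`. -/
abbrev UpperPair (N : ℕ) : Type := {p : Fin N × Fin N // p.1 < p.2}

/-- The real coordinates `A i i`, `√2 Re (A i j)`, `√2 Im (A i j)` (`i < j`) of a Hermitian
matrix `A`. -/
def wignerCoord {N : ℕ} (A : Matrix (Fin N) (Fin N) ℂ) :
    Fin N ⊕ UpperPair N ⊕ UpperPair N → ℝ
  | Sum.inl i => (A i i).re
  | Sum.inr (Sum.inl p) => Real.sqrt 2 * (A p.1.1 p.1.2).re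
  | Sum.inr (Sum.inr p) => Real.sqrt 2 * (A p.1.1 p.1.2).im

/-- `X` is an `N` complex Wigner matrix (a matrix of the Gaussian Unitary Ensemble): a random
Hermitian matrix for which the variables `X i i`, `√2 Re (X i j)`, `√2 Im (X i j)`, `i < j`, are
independent standard Gaussians. -/
structure IsComplexWigner {Ω : Type*} [MeasurableSpace Ω] (P : Measure Ω) {N : ℕ}
    (X : Ω → Matrix (Fin N) (Fin N) ℂ) : Prop where
  measurable : ∀ i j, Measurable fun ω => X ω i j
  isHermitian : ∀ ω, (X ω).IsHermitian
  hasLaw : ∀ k, HasLaw (fun ω => wignerCoord (X ω) k) (gaussianReal 0 1) P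
  indep : iIndepFun (fun k ω => wignerCoord (X ω) k) P

/-- The set of real eigenvalues of a complex matrix. -/
def realEigenvalues {N : ℕ} (A : Matrix (Fin N) (Fin N) ℂ) : Set ℝ :=
  {x | Module.End.HasEigenvalue (Matrix.toLin' A) (x : ℂ)}

/-- The largest real eigenvalue. -/
def lambdaMax {N : ℕ} (A : Matrix (Fin N) (Fin N) ℂ) : ℝ := sSup (realEigenvalues A)

/-- The smallest real eigenvalue. -/
def lambdaMin {N : ℕ} (A : Matrix (Fin N) (Fin N) ℂ) : ℝ := sInf (realEigenvalues A)

theorem realEigenvalues_eq_range {N : ℕ} {A : Matrix (Fin N) (Fin N) ℂ} (hA : A.IsHermitian) :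
    realEigenvalues A = Set.range hA.eigenvalues := by
  rw [← hA.spectrum_real_eq_range_eigenvalues]
  ext x
  rw [realEigenvalues, Set.mem_ofPred_eq, Module.End.hasEigenvalue_iff_mem_spectrum,
    Matrix.spectrum_toLin', ← spectrum.algebraMap_mem_iff ℂ]
  rfl

/-- For a Hermitian matrix of positive size the supremum is a maximum. -/
theorem lambdaMax_isGreatest {N : ℕ} (hN : 1 ≤ N) {A : Matrix (Fin N) (Fin N) ℂ}
    (hA : A.IsHermitian) : IsGreatest (realEigenvalues A) (lambdaMax A) := by
  have hfin : (realEigenvalues A).Finite := by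
    rw [realEigenvalues_eq_range hA]; exact Set.finite_range _
  have hne : (realEigenvalues A).Nonempty := by
    rw [realEigenvalues_eq_range hA]; exact ⟨_, ⟨⟨0, hN⟩, rfl⟩⟩
  exact ⟨hne.csSup_mem hfin, fun x hx => le_csSup hfin.bddAbove hx⟩

/-- For a Hermitian matrix of positive size the infimum is a minimum. -/
theorem lambdaMin_isLeast {N : ℕ} (hN : 1 ≤ N) {A : Matrix (Fin N) (Fin N) ℂ}
    (hA : A.IsHermitian) : IsLeast (realEigenvalues A) (lambdaMin A) := by
  have hfin : (realEigenvalues A).Finite := by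
    rw [realEigenvalues_eq_range hA]; exact Set.finite_range _
  have hne : (realEigenvalues A).Nonempty := by
    rw [realEigenvalues_eq_range hA]; exact ⟨_, ⟨⟨0, hN⟩, rfl⟩⟩
  exact ⟨hne.csInf_mem hfin, fun x hx => csInf_le hfin.bddBelow hx⟩

end

/-! The proof is the method of moments, with orders that grow with `N`. Gaussian integration by
parts yields the loop equations E[Tr A^(a+1) F] = E[Σ_{i<a} Tr A^i Tr A^(a-1-i) F] + E[D_a F] for
polynomials F in the traces Tr A^k, where D_a is the derivative in the direction A^a. They lower the
degree and have natural coefficients, so inequalities for the expectation T propagate by induction: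
T is nonnegative, traces are positively correlated (`mul_le`), and the covariance of Tr A^k and Tr
A^l is at most k l E[Tr A^(k+l-2)] (`le_mul_add`). The normalized even moments therefore satisfy the
Catalan recursion up to an error of relative order p^3 / N^2.

For fixed orders, the moments tend to those of the semicircle law and the variances of the
normalized traces are O(N^-2), hence summable: almost surely the empirical moments converge
(`ae_tendsto_trace_pow`). At order 2⌊√N⌋, far above log N but with p^3 / N^2 still small, the
expected trace is summably small compared with (2 + ε)^(2⌊√N⌋) after rescaling, so almost surely no
eigenvalue eventually exceeds 2 + ε in modulus (`ae_eventually_abs_eigenvalues_le`). Given this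
confinement, the limiting moments force eigenvalues near 2 and -2. Almost sure statements come from
summable expectations, whatever the joint law. -/

/-- Polynomials with natural coefficients in the formal power traces `X k`. -/
abbrev TracePoly : Type := MvPolynomial ℕ ℕ

/-! ### Formal calculus of trace polynomials. -/

namespace TracePoly

open MvPolynomial

/-- The derivation `X k ↦ k X (k + c - 1)`: the derivative in the direction of the `c`-th matrix
power. -/
noncomputable def powDeriv (c : ℕ) : Derivation ℕ TracePoly TracePoly :=
  mkDerivation ℕ fun k => (k : TracePoly) * X (k + c - 1)

/-- `∑ X i X j` over `i + j + 1 = a`: the formal divergence of the `a`-th matrix power. -/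
noncomputable def split (a : ℕ) : TracePoly :=
  ∑ i ∈ Finset.range a, X i * X (a - 1 - i)

@[simp] theorem powDeriv_X (c k : ℕ) : powDeriv c (X k) = (k : TracePoly) * X (k + c - 1) :=
  mkDerivation_X _ _ _

@[simp] theorem powDeriv_natCast (c n : ℕ) : powDeriv c (n : TracePoly) = 0 :=
  (powDeriv c).map_natCast n

theorem powDeriv_X_mul (c k : ℕ) (F : TracePoly) :
    powDeriv c (X k * F) = (k : TracePoly) * X (k + c - 1) * F + X k * powDeriv c F := by
  rw [Derivation.leibniz, powDeriv_X, smul_eq_mul, smul_eq_mul]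
  ring

/-- This is the Witt algebra relation [D_a, D_c] = (c - a) D_{a+c-1} of the vector fields x^a d/dx,
with the negative term moved across because coefficients are natural numbers. -/
theorem powDeriv_comm (a c : ℕ) (F : TracePoly) :
    powDeriv a (powDeriv c F) + (a : TracePoly) * powDeriv (a + c - 1) F =
      powDeriv c (powDeriv a F) + (c : TracePoly) * powDeriv (a + c - 1) F := by
  induction F using MvPolynomial.induction_on with
  | C n => simp
  | add p q hp hq =>
    simp only [map_add, mul_add]
    linear_combination hp + hq
  | mul_X p k hp =>
    rw [mul_comm p]
    have hX : powDeriv a (powDeriv c (X k)) + (a : TracePoly) * powDeriv (a + c - 1) (X k) =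
        powDeriv c (powDeriv a (X k)) + (c : TracePoly) * powDeriv (a + c - 1) (X k) := by
      rcases k with _ | k
      · simp
      simp only [powDeriv_X, Derivation.leibniz, smul_eq_mul, powDeriv_natCast, mul_zero, add_zero]
      by_cases hac : a + c = 0
      · obtain ⟨rfl, rfl⟩ : a = 0 ∧ c = 0 := by omega
        ring
      rcases k with _ | k
      · rcases a with _ | a <;> rcases c with _ | c
        · simp at hac
        · simp 
        · simp 
        · have e1 : 0 + 1 + (c + 1) - 1 + (a + 1) - 1 = a + 1 + c := by omega
          have e2 : 0 + 1 + (a + 1) - 1 + (c + 1) - 1 = a + 1 + c := by omega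
          have e4 : 0 + 1 + (c + 1) - 1 = c + 1 := by omega
          have e5 : 0 + 1 + (a + 1) - 1 = a + 1 := by omega
          rw [e1, e2, e4, e5, show 0 + 1 + (a + 1 + (c + 1) - 1) - 1 = a + 1 + c by omega]
          push_cast
          ring
      · have e1 : k + 1 + 1 + c - 1 + a - 1 = k + a + c := by omega
        have e2 : k + 1 + 1 + a - 1 + c - 1 = k + a + c := by omega
        have e3 : k + 1 + 1 + (a + c - 1) - 1 = k + a + c := by omega
        have e4 : k + 1 + 1 + c - 1 = k + 1 + c := by omega
        have e5 : k + 1 + 1 + a - 1 = k + 1 + a := by omega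
        rw [e1, e2, e3, e4, e5]
        push_cast
        ring
    simp only [Derivation.leibniz, smul_eq_mul, map_add] at hX ⊢
    linear_combination (X k) * hp + p * hX

/-- `HasWeightLE n F`: the monomials of `F` have weight at most `n`, where `X k` has weight `k`. -/
inductive HasWeightLE : ℕ → TracePoly → Prop
  | const (n c : ℕ) : HasWeightLE n (c : TracePoly)
  | add {n : ℕ} {F G : TracePoly} : HasWeightLE n F → HasWeightLE n G → HasWeightLE n (F + G)
  | X_mul {n : ℕ} (k : ℕ) {F : TracePoly} : HasWeightLE n F → HasWeightLE (n + k) (X k * F)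

namespace HasWeightLE

theorem mono {n m : ℕ} {F : TracePoly} (h : HasWeightLE n F) (hnm : n ≤ m) : HasWeightLE m F := by
  induction h generalizing m with
  | const n c => exact const m c
  | add _ _ h₁ h₂ => exact add (h₁ hnm) (h₂ hnm)
  | @X_mul n k F _ h =>
    have := X_mul k (h (m := m - k) (by omega))
    rwa [Nat.sub_add_cancel (by omega)] at this

theorem zero (n : ℕ) : HasWeightLE n 0 := by simpa using const n 0

theorem sum {ι : Type*} {n : ℕ} (s : Finset ι) (F : ι → TracePoly)
    (h : ∀ i ∈ s, HasWeightLE n (F i)) : HasWeightLE n (∑ i ∈ s, F i) :=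
  Finset.sum_induction F (HasWeightLE n) (fun _ _ => add) (zero n) h

theorem natCast_mul {n : ℕ} {F : TracePoly} (h : HasWeightLE n F) (c : ℕ) :
    HasWeightLE n ((c : TracePoly) * F) := by
  induction c with
  | zero => simpa using zero n
  | succ c ih => rw [Nat.cast_succ, add_mul, one_mul]; exact ih.add h

theorem exists_weight (F : TracePoly) : ∃ n, HasWeightLE n F := by
  induction F using MvPolynomial.induction_on with
  | C c => exact ⟨0, by simpa using const 0 c⟩
  | add p q hp hq =>
    obtain ⟨n, hn⟩ := hp
    obtain ⟨m, hm⟩ := hq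
    exact ⟨n + m, (hn.mono (by omega)).add (hm.mono (by omega))⟩
  | mul_X p k hp =>
    obtain ⟨n, hn⟩ := hp
    exact ⟨n + k, by rw [mul_comm]; exact X_mul k hn⟩

/-- In weight zero only constants and `X 0` occur, and every `powDeriv c` kills both. -/
theorem powDeriv_eq_zero {n : ℕ} {F : TracePoly} (h : HasWeightLE n F) (hn : n = 0) (c : ℕ) :
    powDeriv c F = 0 := by
  induction h with
  | const n c => simp
  | add _ _ h₁ h₂ => simp [h₁ hn, h₂ hn]
  | @X_mul n k F _ h =>
    obtain rfl : k = 0 := by omega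
    simp [h (by omega)]

theorem powDeriv {n : ℕ} {F : TracePoly} (h : HasWeightLE n F) (c : ℕ) :
    HasWeightLE (n + c - 1) (powDeriv c F) := by
  induction h with
  | const n k => simpa using zero _
  | add _ _ h₁ h₂ => rw [map_add]; exact h₁.add h₂
  | @X_mul n k F hF h =>
    rw [powDeriv_X_mul]
    refine add ?_ ?_
    · rcases k with _ | k
      · simpa using zero _
      rw [mul_assoc]
      exact ((X_mul _ hF).mono (by omega)).natCast_mul _
    -- For `n = 0` and `c = 0` the truncated weight `n + c - 1` would be one too large, so the
    -- vanishing of the derivative is needed.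
    · rcases n with _ | n
      · rw [hF.powDeriv_eq_zero rfl, mul_zero]
        exact zero _
      · exact (X_mul k h).mono (by omega)

theorem split_mul {n : ℕ} {F : TracePoly} (h : HasWeightLE n F) (a : ℕ) :
    HasWeightLE (n + (a - 1)) (split a * F) := by
  rw [split, Finset.sum_mul]
  refine sum _ _ fun i hi => ?_
  rw [Finset.mem_range] at hi
  rw [mul_assoc]
  exact (X_mul i (X_mul (a - 1 - i) h)).mono (by omega)

end HasWeightLE

/-- Induction on trace polynomials along the loop equation. -/
theorem loop_induction {p : TracePoly → Prop} (const : ∀ c : ℕ, p c)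
    (add : ∀ F G, p F → p G → p (F + G)) (zero : ∀ F, p F → p (X 0 * F))
    (succ : ∀ a F, p (split a * F) → p (powDeriv a F) → p (X (a + 1) * F)) (F : TracePoly) :
    p F := by
  have key : ∀ n : ℕ, ∀ F, HasWeightLE n F → p F := by
    intro n
    induction n using Nat.strong_induction_on with
    | _ n ih =>
      intro F hF
      induction hF with
      | const n c => exact const c
      | add _ _ h₁ h₂ => exact add _ _ (h₁ ih) (h₂ ih)
      | @X_mul n k F hF h =>
        rcases k with _ | a
        · exact zero _ (h ih)
        -- Both terms of the loop equation have strictly smaller weight than `X (a + 1) * F`, which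
        -- makes the recursion well founded.
        · refine succ a F (ih _ ?_ _ (hF.split_mul a)) ?_
          · omega
          · by_cases h0 : n + a = 0
            · rw [hF.powDeriv_eq_zero (by omega)]
              simpa using const 0
            · exact ih _ (by omega) _ (hF.powDeriv a)
  obtain ⟨n, hn⟩ := HasWeightLE.exists_weight F
  exact key n F hn

/-! ### Positivity and correlation inequalities from the loop equations. -/

/-- A normalized functional on trace polynomials that satisfies the loop (Schwinger-Dyson)
equations of the Gaussian Unitary Ensemble of size `N`. -/
structure IsLoopFunctional (N : ℕ) (T : TracePoly →+ ℝ) : Prop where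
  map_one : T 1 = 1
  map_X_zero_mul : ∀ F, T (X 0 * F) = N * T F
  map_X_succ_mul : ∀ a F, T (X (a + 1) * F) = T (split a * F) + T (powDeriv a F)

namespace IsLoopFunctional

variable {N : ℕ} {T : TracePoly →+ ℝ} (hT : IsLoopFunctional N T)

theorem map_natCast_mul (T : TracePoly →+ ℝ) (c : ℕ) (F : TracePoly) :
    T ((c : TracePoly) * F) = c * T F := by
  rw [← nsmul_eq_mul, map_nsmul, nsmul_eq_mul]

include hT

theorem map_natCast (c : ℕ) : T c = c := by
  rw [← mul_one (c : TracePoly), map_natCast_mul, hT.map_one, mul_one]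

theorem nonneg (F : TracePoly) : 0 ≤ T F := by
  induction F using loop_induction with
  | const c => rw [hT.map_natCast]; positivity
  | add F G hF hG => rw [map_add]; positivity
  | zero F hF => rw [hT.map_X_zero_mul]; positivity
  | succ a F h₁ h₂ => rw [hT.map_X_succ_mul]; positivity

/-- In the loop equation for `X b * F`, the derivative also hits the factor `X b`; this only adds a
nonnegative term. -/
theorem mul_le (b : ℕ) (F : TracePoly) : T (X b) * T F ≤ T (X b * F) := by
  induction F using loop_induction with
  | const c => rw [mul_comm (X b), map_natCast_mul, hT.map_natCast, mul_comm]
  | add F G hF hG => rw [mul_add, map_add, map_add]; linarith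
  | zero F hF =>
    rw [mul_left_comm, hT.map_X_zero_mul, hT.map_X_zero_mul]
    have := mul_le_mul_of_nonneg_left hF (Nat.cast_nonneg (α := ℝ) N)
    linarith
  | succ a F h₁ h₂ =>
    rw [mul_left_comm, hT.map_X_succ_mul, hT.map_X_succ_mul, powDeriv_X_mul, map_add]
    have := hT.nonneg ((b : TracePoly) * X (b + a - 1) * F)
    rw [mul_left_comm] at h₁
    linarith

/-- Differentiating either factor of the products in `split a` contributes to X_j X_{a+c-2-j} the
coefficients (j-c+1)^+ and (a-1-j)^+; their sum never exceeds `a`. -/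
theorem powDeriv_split_le (c a : ℕ) (ha : 1 ≤ a) (F : TracePoly) :
    T (powDeriv c (split a) * F) ≤ a * T (split (a + c - 1) * F) := by
  have hD : powDeriv c (split a) * F =
      ∑ i ∈ Finset.range a, (i : TracePoly) * (X (i + c - 1) * X (a - 1 - i) * F) +
      ∑ i ∈ Finset.range a, (i : TracePoly) * (X (i + c - 1) * X (a - 1 - i) * F) := by
    nth_rewrite 2 [← Finset.sum_range_reflect]
    rw [split, map_sum, Finset.sum_mul, ← Finset.sum_add_distrib]
    refine Finset.sum_congr rfl fun i hi => ?_
    rw [Finset.mem_range] at hi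
    rw [powDeriv_X_mul, powDeriv_X, show a - 1 - (a - 1 - i) = i by omega]
    ring
  rw [hD, map_add, map_sum]
  simp_rw [map_natCast_mul]
  rw [split, Finset.sum_mul, map_sum]
  rcases c with _ | c
  · obtain ⟨a, rfl⟩ : ∃ b, a = b + 1 := ⟨a - 1, by omega⟩
    rw [Finset.sum_range_succ']
    simp only [Nat.cast_zero, zero_mul, add_zero, Nat.add_sub_cancel]
    nth_rewrite 2 [← Finset.sum_range_reflect]
    rw [← Finset.sum_add_distrib, Finset.mul_sum]
    refine Finset.sum_le_sum fun i hi => ?_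
    rw [Finset.mem_range] at hi
    rw [show a - (a - 1 - i + 1) = i by omega, show a - (i + 1) = a - 1 - i by omega,
      mul_comm (X (a - 1 - i)), ← add_mul, ← Nat.cast_add]
    refine mul_le_mul_of_nonneg_right ?_ (hT.nonneg _)
    exact_mod_cast (by omega)
  · have e₁ : ∑ i ∈ Finset.range a, (i : ℝ) * T (X (i + (c + 1) - 1) * X (a - 1 - i) * F) =
        ∑ j ∈ Finset.range (a + (c + 1) - 1),
          ((j - c : ℕ) : ℝ) * T (X j * X (a + (c + 1) - 1 - 1 - j) * F) := by
      rw [show a + (c + 1) - 1 = c + a by omega, Finset.sum_range_add,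
        Finset.sum_eq_zero (s := Finset.range c), zero_add]
      · refine Finset.sum_congr rfl fun i hi => ?_
        rw [Finset.mem_range] at hi
        rw [show c + i - c = i by omega, show i + (c + 1) - 1 = c + i by omega,
          show c + a - 1 - (c + i) = a - 1 - i by omega]
      · intro i hi
        rw [Finset.mem_range] at hi
        rw [show i - c = 0 by omega, Nat.cast_zero, zero_mul]
    have e₂ : ∑ i ∈ Finset.range a, (i : ℝ) * T (X (i + (c + 1) - 1) * X (a - 1 - i) * F) =
        ∑ j ∈ Finset.range (a + (c + 1) - 1),
          ((a - 1 - j : ℕ) : ℝ) * T (X j * X (a + (c + 1) - 1 - 1 - j) * F) := by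
      rw [show a + (c + 1) - 1 = a + c by omega, Finset.sum_range_add,
        Finset.sum_eq_zero (s := Finset.range c), add_zero, ← Finset.sum_range_reflect]
      · refine Finset.sum_congr rfl fun i hi => ?_
        rw [Finset.mem_range] at hi
        rw [show a - 1 - (a - 1 - i) = i by omega,
          show a - 1 - i + (c + 1) - 1 = a + c - 1 - i by omega, mul_comm (X i)]
      · intro i hi
        rw [show a - 1 - (a + i) = 0 by omega, Nat.cast_zero, zero_mul]
    nth_rewrite 1 [e₁]
    rw [e₂, ← Finset.sum_add_distrib, Finset.mul_sum]
    refine Finset.sum_le_sum fun i hi => ?_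
    rw [Finset.mem_range] at hi
    rw [← add_mul, ← Nat.cast_add]
    refine mul_le_mul_of_nonneg_right ?_ (hT.nonneg _)
    exact_mod_cast (by omega)

/-- Covariance bound: correlations are controlled by a directional derivative. -/
theorem le_mul_add (c : ℕ) (F : TracePoly) :
    T (X (c + 1) * F) ≤ T (X (c + 1)) * T F + (c + 1) * T (powDeriv c F) := by
  induction F using loop_induction with
  | const n =>
    rw [mul_comm (X (c + 1)), map_natCast_mul, hT.map_natCast, powDeriv_natCast, map_zero]
    linarith
  | add F G hF hG => simp only [mul_add, map_add]; linarith
  | zero F hF =>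
    rw [mul_left_comm, hT.map_X_zero_mul, hT.map_X_zero_mul, powDeriv_X_mul, Nat.cast_zero,
      zero_mul, zero_mul, zero_add, hT.map_X_zero_mul]
    have := mul_le_mul_of_nonneg_left hF (Nat.cast_nonneg (α := ℝ) N)
    linarith
  | succ a F h₁ h₂ =>
    have hc := congrArg T (powDeriv_comm a c F)
    have hs : powDeriv c (split a * F) = split a * powDeriv c F + powDeriv c (split a) * F := by
      rw [Derivation.leibniz, smul_eq_mul, smul_eq_mul, mul_comm F]
    -- By `powDeriv_split_le`, the left side is at most `a` times the right side of the loop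
    -- equation for `X (a + c) * F`. It absorbs the error made when `powDeriv c` is commuted past
    -- `split a` and `powDeriv a`.
    have key : T (powDeriv c (split a) * F) + a * T (powDeriv (a + c - 1) F) ≤
        a * T (X (a + c) * F) := by
      rcases Nat.eq_zero_or_pos a with rfl | ha
      · simp [split]
      · have h := hT.powDeriv_split_le c a ha F
        have h' := hT.map_X_succ_mul (a + c - 1) F
        rw [show a + c - 1 + 1 = a + c by omega] at h'
        rw [h', mul_add]
        linarith
    have hpos : 0 ≤ (c : ℝ) * T (powDeriv (a + c - 1) F) :=
      mul_nonneg (Nat.cast_nonneg _) (hT.nonneg _)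
    rw [mul_left_comm, hT.map_X_succ_mul, hT.map_X_succ_mul, powDeriv_X_mul a, powDeriv_X_mul c,
      map_add, map_add, hT.map_X_succ_mul a (powDeriv c F), mul_assoc, mul_assoc,
      map_natCast_mul, map_natCast_mul, show c + 1 + a - 1 = a + c by omega, show a + 1 + c - 1 = a + c by omega, mul_left_comm]
    rw [hs, map_add] at h₁
    rw [map_add, map_add, map_natCast_mul, map_natCast_mul] at hc
    push_cast
    have h3 : ((c : ℝ) + 1) * (T (powDeriv c (powDeriv a F)) + T (powDeriv c (split a) * F)) ≤
        ((c : ℝ) + 1) * (T (powDeriv a (powDeriv c F)) + a * T (X (a + c) * F)) := by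
      refine mul_le_mul_of_nonneg_left ?_ (by positivity)
      linarith
    linarith

theorem map_X_mul_X_le (a b : ℕ) :
    T (X (a + 1) * X (b + 1)) ≤
      T (X (a + 1)) * T (X (b + 1)) + (a + 1) * (b + 1) * T (X (a + b)) := by
  have h := hT.le_mul_add a (X (b + 1))
  rw [powDeriv_X, map_natCast_mul, show b + 1 + a - 1 = a + b by omega] at h
  push_cast at h
  linarith

theorem map_X_zero : T (X 0) = N := by
  have := hT.map_X_zero_mul 1
  rwa [mul_one, hT.map_one, mul_one] at this

theorem map_X_succ (a : ℕ) :
    T (X (a + 1)) = ∑ i ∈ Finset.range a, T (X i * X (a - 1 - i)) := by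
  have := hT.map_X_succ_mul a 1
  rwa [mul_one, mul_one, Derivation.map_one_eq_zero, map_zero, add_zero, split, map_sum] at this

theorem map_X_zero_mul_X (b : ℕ) : T (X 0 * X b) = T (X 0) * T (X b) := by
  rw [hT.map_X_zero_mul, hT.map_X_zero]

theorem map_X_mul_X_le' (a b : ℕ) :
    T (X a * X b) ≤ T (X a) * T (X b) + a * b * T (X (a + b - 2)) := by
  rcases a with _ | a
  · rw [hT.map_X_zero_mul_X]; simp
  rcases b with _ | b
  · rw [mul_comm, hT.map_X_zero_mul_X]; simp [mul_comm]
  have := hT.map_X_mul_X_le a b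
  rw [show a + 1 + (b + 1) - 2 = a + b by omega]
  push_cast
  exact this

/-- In each product of the recursion one index is odd, and the index in the covariance error is odd
too, so the upper bound vanishes by induction. -/
theorem map_X_odd (k : ℕ) : Odd k → T (X k) = 0 := by
  induction k using Nat.strong_induction_on with
  | _ k ih =>
    intro hk
    obtain ⟨a, rfl⟩ : ∃ a, k = a + 1 := ⟨k - 1, by have := hk.pos; omega⟩
    rw [hT.map_X_succ]
    refine Finset.sum_eq_zero fun i hi => ?_
    rw [Finset.mem_range] at hi
    refine le_antisymm ((hT.map_X_mul_X_le' _ _).trans_eq ?_) (hT.nonneg _)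
    have hprod : T (X i) * T (X (a - 1 - i)) = 0 := by
      rcases Nat.even_or_odd i with h | h
      · rw [ih (a - 1 - i) (by omega) (by grind), mul_zero]
      · rw [ih i (by omega) h, zero_mul]
    -- For small `a` the index of the error term is truncated and may be even, but then one of the
    -- two indices is zero and the prefactor vanishes.
    rcases Nat.lt_or_ge a 3 with h3 | h3
    · rw [hprod]
      have : i = 0 ∨ a - 1 - i = 0 := by grind
      rcases this with h | h <;> simp [h]
    · rw [hprod, ih (i + (a - 1 - i) - 2) (by omega) (by grind)]
      simp

end IsLoopFunctional
end TracePoly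

/-! ### Even moments and the perturbed Catalan recursion. -/

theorem Finset.sum_range_two_mul_add_one_of_odd_eq_zero {M : Type*} [AddCommMonoid M] (f : ℕ → M)
    (hf : ∀ i, Odd i → f i = 0) (p : ℕ) :
    ∑ i ∈ Finset.range (2 * p + 1), f i = ∑ j ∈ Finset.range (p + 1), f (2 * j) := by
  induction p with
  | zero => simp
  | succ p ih =>
    rw [Finset.sum_range_succ _ (p + 1), ← ih, show 2 * (p + 1) + 1 = 2 * p + 1 + 1 + 1 by ring,
      Finset.sum_range_succ, Finset.sum_range_succ, hf (2 * p + 1) ⟨p, rfl⟩, add_zero]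
    rfl

theorem Nat.catalan_succ_eq_sum_range (p : ℕ) :
    catalan (p + 1) = ∑ j ∈ Finset.range (p + 1), catalan j * catalan (p - j) := by
  rw [catalan_succ, ← Fin.sum_univ_eq_sum_range (fun j => catalan j * catalan (p - j))]

theorem Nat.catalan_le_four_pow (p : ℕ) : catalan p ≤ 4 ^ p := by
  rw [catalan_eq_centralBinom_div]
  exact (Nat.div_le_self _ _).trans (Nat.centralBinom_le_four_pow p)

theorem Nat.catalan_mono : Monotone catalan := by
  refine monotone_nat_of_le_succ fun n => ?_
  rw [catalan_succ_eq_sum_range, Finset.sum_range_succ', catalan_zero, one_mul, Nat.sub_zero]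
  exact Nat.le_add_left _ _

namespace TracePoly.IsLoopFunctional

open MvPolynomial

variable {N : ℕ} {T : TracePoly →+ ℝ}

/-- The normalized even moments. -/
noncomputable def evenMoment (N : ℕ) (T : TracePoly →+ ℝ) (p : ℕ) : ℝ :=
  T (X (2 * p)) / (N : ℝ) ^ (p + 1)

theorem evenMoment_nonneg (hT : IsLoopFunctional N T) (p : ℕ) : 0 ≤ evenMoment N T p :=
  div_nonneg (hT.nonneg _) (by positivity)

theorem evenMoment_zero (hT : IsLoopFunctional N T) (hN : N ≠ 0) : evenMoment N T 0 = 1 := by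
  rw [evenMoment, mul_zero, hT.map_X_zero, zero_add, pow_one]
  exact div_self (by exact_mod_cast hN)

theorem sum_evenMoment (hT : IsLoopFunctional N T) (p : ℕ) :
    ∑ j ∈ Finset.range (p + 1), evenMoment N T j * evenMoment N T (p - j) =
      (∑ i ∈ Finset.range (2 * p + 1), T (X i) * T (X (2 * p - i))) / (N : ℝ) ^ (p + 2) := by
  rw [Finset.sum_range_two_mul_add_one_of_odd_eq_zero _ fun i hi => by
    rw [hT.map_X_odd i hi, zero_mul], Finset.sum_div]
  refine Finset.sum_congr rfl fun j hj => ?_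
  rw [Finset.mem_range] at hj
  rw [evenMoment, evenMoment, div_mul_div_comm, ← pow_add,
    show j + 1 + (p - j + 1) = p + 2 by omega, show 2 * (p - j) = 2 * p - 2 * j by omega]

theorem le_evenMoment_succ (hT : IsLoopFunctional N T) (p : ℕ) :
    ∑ j ∈ Finset.range (p + 1), evenMoment N T j * evenMoment N T (p - j) ≤
      evenMoment N T (p + 1) := by
  rw [hT.sum_evenMoment, evenMoment, show 2 * (p + 1) = 2 * p + 1 + 1 by ring, hT.map_X_succ]
  gcongr with i hi
  exact hT.mul_le _ _

theorem evenMoment_succ_le (hT : IsLoopFunctional N T) (hN : N ≠ 0) (p : ℕ) :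
    evenMoment N T (p + 1) ≤
      ∑ j ∈ Finset.range (p + 1), evenMoment N T j * evenMoment N T (p - j) +
        (2 * p + 1) * p ^ 2 / (N : ℝ) ^ 2 * evenMoment N T (p - 1) := by
  have hN' : (0 : ℝ) < N := by exact_mod_cast Nat.pos_of_ne_zero hN
  have key : T (X (2 * (p + 1))) ≤
      ∑ i ∈ Finset.range (2 * p + 1), T (X i) * T (X (2 * p - i)) +
        (2 * p + 1) * p ^ 2 * T (X (2 * (p - 1))) := by
    rw [show 2 * (p + 1) = 2 * p + 1 + 1 by ring, hT.map_X_succ]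
    have : (2 * (p : ℝ) + 1) * p ^ 2 * T (X (2 * (p - 1))) =
        ∑ i ∈ Finset.range (2 * p + 1), (p : ℝ) ^ 2 * T (X (2 * (p - 1))) := by
      rw [Finset.sum_const, Finset.card_range, nsmul_eq_mul]
      push_cast
      ring
    rw [this, ← Finset.sum_add_distrib]
    refine Finset.sum_le_sum fun i hi => ?_
    rw [Finset.mem_range] at hi
    refine (hT.map_X_mul_X_le' _ _).trans ?_
    rw [show i + (2 * p + 1 - 1 - i) - 2 = 2 * (p - 1) by omega,
      show 2 * p + 1 - 1 - i = 2 * p - i by omega]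
    gcongr
    · exact hT.nonneg _
    -- The product i (2p - i) is at most p^2, with equality at i = p.
    · rw [Nat.cast_sub (by omega)]
      push_cast
      nlinarith [sq_nonneg ((p : ℝ) - i)]
  rw [hT.sum_evenMoment]
  rcases p with _ | p
  · simp only [CharP.cast_eq_zero] at key ⊢
    rw [evenMoment]
    have := div_le_div_of_nonneg_right key (pow_nonneg hN'.le 2)
    simpa using this
  · rw [evenMoment, evenMoment, Nat.add_sub_cancel]
    rw [Nat.add_sub_cancel] at key
    rw [div_le_iff₀ (by positivity)]
    refine key.trans_eq ?_
    field_simp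
    ring

/-- Since Catalan numbers increase, the error of each recursion step is at most δ times the main
bound, so each step costs one factor 1 + δ. The bound is uniform up to `P`, which may grow with `N`
as long as P^3 / N^2 stays small. -/
theorem evenMoment_le_of_le (hT : IsLoopFunctional N T) (hN : N ≠ 0) {δ : ℝ} {P : ℕ}
    (hP : (2 * P + 1) * P ^ 2 / (N : ℝ) ^ 2 ≤ δ) (p : ℕ) :
    p ≤ P → evenMoment N T p ≤ catalan p * (1 + δ) ^ p := by
  have hδ : 0 ≤ δ := le_trans (by positivity) hP
  induction p using Nat.strong_induction_on with
  | _ p ih =>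
    intro hp
    rcases p with _ | p
    · simp [hT.evenMoment_zero hN]
    refine (hT.evenMoment_succ_le hN p).trans ?_
    have h₁ : ∑ j ∈ Finset.range (p + 1), evenMoment N T j * evenMoment N T (p - j) ≤
        catalan (p + 1) * (1 + δ) ^ p := by
      rw [Nat.catalan_succ_eq_sum_range, Nat.cast_sum, Finset.sum_mul]
      refine Finset.sum_le_sum fun j hj => ?_
      rw [Finset.mem_range] at hj
      refine (mul_le_mul (ih j (by omega) (by omega)) (ih (p - j) (by omega) (by omega))
        (hT.evenMoment_nonneg _) (by positivity)).trans_eq ?_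
      obtain ⟨k, rfl⟩ : ∃ k, p = j + k := ⟨p - j, by omega⟩
      rw [Nat.add_sub_cancel_left]
      push_cast
      ring
    have h₂ : (2 * p + 1) * p ^ 2 / (N : ℝ) ^ 2 * evenMoment N T (p - 1) ≤
        δ * (catalan (p + 1) * (1 + δ) ^ p) := by
      refine mul_le_mul ?_ ?_ (hT.evenMoment_nonneg _) hδ
      · refine le_trans ?_ hP
        have : (p : ℝ) ≤ P := by exact_mod_cast (by omega)
        gcongr
      · refine (ih (p - 1) (by omega) (by omega)).trans ?_
        gcongr
        · exact_mod_cast Nat.catalan_mono (by omega)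
        · linarith
        · omega
    calc _ ≤ _ := add_le_add h₁ h₂
      _ = _ := by ring

/-- Positive correlation bounds each moment below by the Catalan convolution, the covariance bound
bounds it above with an O(N^-2) error; induction and squeezing conclude. -/
theorem tendsto_evenMoment {T : ℕ → TracePoly →+ ℝ}
    (hT : ∀ N, 1 ≤ N → IsLoopFunctional N (T N)) (p : ℕ) :
    Tendsto (fun N => evenMoment N (T N) p) atTop (𝓝 (catalan p)) := by
  induction p using Nat.strong_induction_on with
  | _ p ih =>
    rcases p with _ | p
    · rw [catalan_zero, Nat.cast_one]
      refine tendsto_const_nhds.congr' ?_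
      filter_upwards [eventually_ge_atTop 1] with N hN
      rw [(hT N hN).evenMoment_zero (by omega)]
    have hsum : Tendsto (fun N => ∑ j ∈ Finset.range (p + 1),
        evenMoment N (T N) j * evenMoment N (T N) (p - j)) atTop (𝓝 (catalan (p + 1))) := by
      rw [Nat.catalan_succ_eq_sum_range, Nat.cast_sum]
      simp_rw [Nat.cast_mul]
      refine tendsto_finsetSum _ fun j hj => ?_
      rw [Finset.mem_range] at hj
      exact (ih j (by omega)).mul (ih (p - j) (by omega))
    have herr : Tendsto (fun N : ℕ => (2 * (p : ℝ) + 1) * p ^ 2 / (N : ℝ) ^ 2 *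
        evenMoment N (T N) (p - 1)) atTop (𝓝 0) := by
      rw [← zero_mul ((catalan (p - 1) : ℕ) : ℝ)]
      refine Tendsto.mul ?_ (ih (p - 1) (by omega))
      exact Tendsto.div_atTop tendsto_const_nhds
        ((tendsto_pow_atTop two_ne_zero).comp tendsto_natCast_atTop_atTop)
    refine tendsto_of_tendsto_of_tendsto_of_le_of_le' hsum (by simpa using hsum.add herr) ?_ ?_
    · filter_upwards [eventually_ge_atTop 1] with N hN
      exact (hT N hN).le_evenMoment_succ p
    · filter_upwards [eventually_ge_atTop 1] with N hN
      exact (hT N hN).evenMoment_succ_le (by omega) p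

end TracePoly.IsLoopFunctional

/-! ### Gaussian integration by parts. -/

namespace ProbabilityTheory

theorem integrable_pow_gaussianReal (n : ℕ) :
    Integrable (fun x : ℝ => x ^ n) (gaussianReal 0 1) := by
  rcases n.eq_zero_or_pos with rfl | hn
  · simp
  have h := (memLp_id_gaussianReal' (μ := 0) (v := 1) (n : ENNReal) (by simp)).integrable_norm_pow
    (by omega)
  refine h.mono (by fun_prop) (ae_of_all _ fun x => ?_)
  simp

theorem integrable_pow_mul_gaussianPDFReal (n : ℕ) :
    Integrable fun x : ℝ => x ^ n * gaussianPDFReal 0 1 x := by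
  have h := integrable_pow_gaussianReal n
  rw [gaussianReal_of_var_ne_zero _ one_ne_zero,
    integrable_withDensity_iff (measurable_gaussianPDF 0 1) (ae_of_all _ fun _ => by
      simp [gaussianPDF])] at h
  simpa [toReal_gaussianPDF] using h

theorem hasDerivAt_gaussianPDFReal (x : ℝ) :
    HasDerivAt (gaussianPDFReal 0 1) (-(x * gaussianPDFReal 0 1 x)) x := by
  rw [gaussianPDFReal_def]
  have h : HasDerivAt (fun y : ℝ => -(y - 0) ^ 2 / (2 * ((1 : NNReal) : ℝ))) (-x) x := by
    have := (((hasDerivAt_id x).sub_const 0).pow 2).neg.div_const (2 * ((1 : NNReal) : ℝ))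
    convert! this using 1
    simp
    ring
  convert! (h.exp.const_mul _) using 1
  ring

/-- Gaussian integration by parts for monomials. -/
theorem integral_pow_succ_gaussianReal (n : ℕ) :
    ∫ x, x ^ (n + 1) ∂(gaussianReal 0 1) = n * ∫ x, x ^ (n - 1) ∂(gaussianReal 0 1) := by
  rw [integral_gaussianReal_eq_integral_smul one_ne_zero,
    integral_gaussianReal_eq_integral_smul one_ne_zero, ← integral_const_mul]
  simp only [smul_eq_mul]
  have h := integral_mul_deriv_eq_deriv_mul_of_integrable (u := fun x : ℝ => x ^ n)
    (v := gaussianPDFReal 0 1) (u' := fun x : ℝ => n * x ^ (n - 1))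
    (v' := fun x => -(x * gaussianPDFReal 0 1 x)) (fun x _ => hasDerivAt_pow n x)
    (fun x _ => hasDerivAt_gaussianPDFReal x)
    (by
      refine (integrable_pow_mul_gaussianPDFReal (n + 1)).neg.congr (ae_of_all _ fun x => ?_)
      simp only [Pi.neg_apply, Pi.mul_apply]
      ring)
    (by
      refine ((integrable_pow_mul_gaussianPDFReal (n - 1)).const_mul (n : ℝ)).congr
        (ae_of_all _ fun x => ?_)
      simp only [Pi.mul_apply]
      ring)
    (integrable_pow_mul_gaussianPDFReal n)
  have h' := congrArg Neg.neg h
  rw [neg_neg, ← integral_neg] at h'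
  calc _ = ∫ x : ℝ, -(x ^ n * -(x * gaussianPDFReal 0 1 x)) := by
        refine integral_congr_ae (ae_of_all _ fun x => ?_)
        ring
    _ = _ := h'
    _ = _ := by
        refine integral_congr_ae (ae_of_all _ fun x => ?_)
        ring

theorem integrable_ofReal_pow_gaussianReal (n : ℕ) :
    Integrable (fun x : ℝ => (x : ℂ) ^ n) (gaussianReal 0 1) := by
  simpa using (integrable_pow_gaussianReal n).ofReal (𝕜 := ℂ)

theorem integral_ofReal_pow_succ_gaussianReal (n : ℕ) :
    ∫ x : ℝ, (x : ℂ) ^ (n + 1) ∂(gaussianReal 0 1) =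
      n * ∫ x : ℝ, (x : ℂ) ^ (n - 1) ∂(gaussianReal 0 1) := by
  have h := congrArg ((↑) : ℝ → ℂ) (integral_pow_succ_gaussianReal n)
  rw [Complex.ofReal_mul, ← integral_complex_ofReal, ← integral_complex_ofReal] at h
  simpa using h

section MvPolynomial

open MvPolynomial

variable {ι : Type*} [Fintype ι]

theorem integrable_eval_pi_gaussianReal (f : MvPolynomial ι ℂ) :
    Integrable (fun x : ι → ℝ => eval (fun i => (x i : ℂ)) f)
      (Measure.pi fun _ : ι => gaussianReal 0 1) := by
  induction f using MvPolynomial.induction_on' with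
  | monomial s a =>
    simp only [eval_monomial, Finsupp.prod_fintype _ _ fun _ => pow_zero _]
    exact (Integrable.fintype_prod fun i => integrable_ofReal_pow_gaussianReal (s i)).const_mul a
  | add p q hp hq =>
    simp only [map_add]
    exact hp.add hq

theorem integral_eval_monomial_pi_gaussianReal (s : ι →₀ ℕ) (a : ℂ) :
    ∫ x : ι → ℝ, eval (fun i => (x i : ℂ)) (monomial s a)
      ∂(Measure.pi fun _ : ι => gaussianReal 0 1) =
    a * ∏ i, ∫ x : ℝ, (x : ℂ) ^ s i ∂(gaussianReal 0 1) := by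
  simp only [eval_monomial, Finsupp.prod_fintype _ _ fun _ => pow_zero _]
  rw [integral_const_mul, integral_fintype_prod_eq_prod (𝕜 := ℂ) (fun i (x : ℝ) => (x : ℂ) ^ s i)]

/-- Gaussian integration by parts for polynomials. -/
theorem integral_eval_X_mul_pi_gaussianReal (k : ι) (f : MvPolynomial ι ℂ) :
    ∫ x : ι → ℝ, eval (fun i => (x i : ℂ)) (X k * f)
      ∂(Measure.pi fun _ : ι => gaussianReal 0 1) =
    ∫ x : ι → ℝ, eval (fun i => (x i : ℂ)) (pderiv k f)
      ∂(Measure.pi fun _ : ι => gaussianReal 0 1) := by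
  classical
  induction f using MvPolynomial.induction_on' with
  | monomial s a =>
    rw [X, monomial_mul, one_mul, pderiv_monomial, integral_eval_monomial_pi_gaussianReal,
      integral_eval_monomial_pi_gaussianReal, ← Finset.mul_prod_erase _ _ (Finset.mem_univ k),
      ← Finset.mul_prod_erase _ (fun i => ∫ x : ℝ, (x : ℂ) ^ (s - Finsupp.single k 1 : ι →₀ ℕ) i
        ∂(gaussianReal 0 1)) (Finset.mem_univ k)]
    have : ∀ i ∈ Finset.univ.erase k, (Finsupp.single k 1 + s : ι →₀ ℕ) i =
        (s - Finsupp.single k 1 : ι →₀ ℕ) i := by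
      intro i hi
      have hik : k ≠ i := (Finset.ne_of_mem_erase hi).symm
      simp [Finsupp.single_eq_of_ne' hik]
    rw [Finset.prod_congr rfl fun i hi => by rw [this i hi]]
    simp only [Finsupp.add_apply, Finsupp.tsub_apply, Finsupp.single_eq_same]
    rw [add_comm 1, integral_ofReal_pow_succ_gaussianReal]
    ring
  | add p q hp hq =>
    simp only [mul_add, map_add]
    simp only [map_mul] at hp ⊢
    have e (f : MvPolynomial ι ℂ) := integrable_eval_pi_gaussianReal f
    have e₁ := e (X k * p)
    have e₂ := e (X k * q)
    simp only [map_mul] at e₁ e₂ hq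
    rw [integral_add e₁ e₂, integral_add (e _) (e _), hp, hq]

variable {Ω : Type*} [MeasurableSpace Ω] {P : Measure Ω} {g : ι → Ω → ℝ}

theorem iIndepFun.integrable_eval_of_gaussian (hg : ∀ k, HasLaw (g k) (gaussianReal 0 1) P)
    (hi : iIndepFun g P) (f : MvPolynomial ι ℂ) :
    Integrable (fun ω => eval (fun i => (g i ω : ℂ)) f) P := by
  have h := hi.hasLaw_pi hg
  have h' := integrable_eval_pi_gaussianReal f
  rw [← h.map_eq] at h'
  exact h'.comp_aemeasurable h.aemeasurable

theorem iIndepFun.integral_eval_X_mul_of_gaussian (hg : ∀ k, HasLaw (g k) (gaussianReal 0 1) P)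
    (hi : iIndepFun g P) (k : ι) (f : MvPolynomial ι ℂ) :
    ∫ ω, eval (fun i => (g i ω : ℂ)) (X k * f) ∂P =
      ∫ ω, eval (fun i => (g i ω : ℂ)) (pderiv k f) ∂P := by
  have h := hi.hasLaw_pi hg
  have key (f : MvPolynomial ι ℂ) : ∫ ω, eval (fun i => (g i ω : ℂ)) f ∂P =
      ∫ x : ι → ℝ, eval (fun i => (x i : ℂ)) f ∂(Measure.pi fun _ : ι => gaussianReal 0 1) :=
    h.integral_comp (f := fun x : ι → ℝ => eval (fun i => (x i : ℂ)) f)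
      (integrable_eval_pi_gaussianReal f).aestronglyMeasurable
  rw [key, key, integral_eval_X_mul_pi_gaussianReal]

end MvPolynomial

end ProbabilityTheory

/-! ### Divergence of matrix powers, algebraically. -/

section LoopEquation

variable {𝕜 R n : Type*} [CommRing 𝕜] [CommRing R] [Algebra 𝕜 R] [Fintype n] [DecidableEq n]
  {A : Matrix n n R} {d : n → n → Derivation 𝕜 R R}

/-- The derivations `d i j` are dual to the entries `A j i`. -/
def IsDualDerivation (A : Matrix n n R) (d : n → n → Derivation 𝕜 R R) : Prop :=
  ∀ i j l m, d i j (A l m) = if i = m ∧ j = l then 1 else 0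

namespace IsDualDerivation

variable (hd : IsDualDerivation A d)
include hd

/-- By Leibniz, `d i j` removes one factor `A j i` from a path from `l` to `m`; `p` is the position
of the removed factor. -/
theorem apply_pow (a : ℕ) (i j l m : n) :
    d i j ((A ^ a) l m) = ∑ p ∈ Finset.range a, (A ^ p) l j * (A ^ (a - 1 - p)) i m := by
  induction a generalizing l m with
  | zero =>
    rw [pow_zero, Finset.sum_range_zero, Matrix.one_apply]
    split_ifs <;> simp
  | succ a ih =>
    have h₁ : ∑ r, (A ^ a) l r * d i j (A r m) = (A ^ a) l j * (1 : Matrix n n R) i m := by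
      rw [Finset.sum_eq_single j, hd]
      · simp [Matrix.one_apply]
      · intro r _ hr
        rw [hd, if_neg (fun h => hr h.2.symm), mul_zero]
      · simp
    have h₂ : ∑ r, A r m * d i j ((A ^ a) l r) =
        ∑ p ∈ Finset.range a, (A ^ p) l j * (A ^ (a - p)) i m := by
      simp_rw [ih, Finset.mul_sum]
      rw [Finset.sum_comm]
      refine Finset.sum_congr rfl fun p hp => ?_
      rw [Finset.mem_range] at hp
      rw [show a - p = a - 1 - p + 1 by omega, pow_succ A (a - 1 - p), Matrix.mul_apply,
        Finset.mul_sum]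
      exact Finset.sum_congr rfl fun r _ => by ring
    rw [pow_succ, Matrix.mul_apply, map_sum]
    simp_rw [Derivation.leibniz, smul_eq_mul]
    rw [Finset.sum_add_distrib, h₁, h₂, Finset.sum_range_succ, add_comm]
    simp

theorem apply_trace_pow (k : ℕ) (i j : n) :
    d i j (A ^ k).trace = k * (A ^ (k - 1)) i j := by
  rw [Matrix.trace, map_sum]
  simp_rw [Matrix.diag_apply, hd.apply_pow]
  rw [Finset.sum_comm]
  have : ∀ p ∈ Finset.range k,
      ∑ l, (A ^ p) l j * (A ^ (k - 1 - p)) i l = (A ^ (k - 1)) i j := by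
    intro p hp
    rw [Finset.mem_range] at hp
    rw [show k - 1 = k - 1 - p + p by omega, pow_add, Matrix.mul_apply,
      show k - 1 - p + p - p = k - 1 - p by omega]
    exact Finset.sum_congr rfl fun l _ => mul_comm _ _
  rw [Finset.sum_congr rfl this, Finset.sum_const, Finset.card_range, nsmul_eq_mul]

-- The derivative along A^a sends Tr A^k to k Tr A^(k+a-1), and Leibniz extends this from generators
-- to all trace polynomials: `powDeriv` is its formal model.
open MvPolynomial in
theorem sum_pow_mul_apply_aeval (a : ℕ) (G : TracePoly) :
    ∑ i, ∑ j, (A ^ a) j i * d i j (aeval (fun k => (A ^ k).trace) G) =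
      aeval (fun k => (A ^ k).trace) (TracePoly.powDeriv a G) := by
  induction G using MvPolynomial.induction_on with
  | C c => simp
  | add p q hp hq => simp only [map_add, mul_add, Finset.sum_add_distrib, hp, hq]
  | mul_X p k hp =>
    have hk : ∑ i, ∑ j, (A ^ a) j i * d i j (A ^ k).trace = k * (A ^ (k + a - 1)).trace := by
      simp_rw [hd.apply_trace_pow]
      rcases k with _ | k
      · simp
      rw [show k + 1 + a - 1 = k + a by omega, pow_add, Matrix.trace, Finset.mul_sum]
      refine Finset.sum_congr rfl fun i _ => ?_
      rw [Matrix.diag_apply, Matrix.mul_apply, Finset.mul_sum]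
      refine Finset.sum_congr rfl fun j _ => ?_
      rw [Nat.add_sub_cancel]
      ring
    rw [map_mul, aeval_X, mul_comm p, TracePoly.powDeriv_X_mul, map_add, map_mul, map_mul, map_mul,
      aeval_X, aeval_X, map_natCast, ← hp, ← hk]
    simp_rw [Derivation.leibniz, smul_eq_mul, mul_add, Finset.sum_add_distrib, Finset.sum_mul,
      Finset.mul_sum]
    congr 1
    · exact Finset.sum_congr rfl fun i _ => Finset.sum_congr rfl fun j _ => by ring
    · exact Finset.sum_congr rfl fun i _ => Finset.sum_congr rfl fun j _ => by ring

open MvPolynomial in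
/-- The divergence of `A ^ a * F`, where `F` is a polynomial in the traces of powers of `A`. -/
theorem sum_apply_pow_mul_aeval (a : ℕ) (G : TracePoly) :
    ∑ i, ∑ j, d i j ((A ^ a) j i * aeval (fun k => (A ^ k).trace) G) =
      aeval (fun k => (A ^ k).trace) (TracePoly.split a * G) +
        aeval (fun k => (A ^ k).trace) (TracePoly.powDeriv a G) := by
  simp_rw [Derivation.leibniz, smul_eq_mul, Finset.sum_add_distrib, hd.sum_pow_mul_apply_aeval]
  rw [add_comm, map_mul, TracePoly.split, map_sum]
  congr 1
  simp_rw [map_mul, aeval_X, ← Finset.mul_sum, hd.apply_pow, Matrix.trace, Matrix.diag_apply,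
    Finset.sum_mul_sum]
  rw [mul_comm]
  congr 1
  rw [Finset.sum_comm, Finset.sum_comm (s := Finset.range a)]
  exact Finset.sum_congr rfl fun i _ => Finset.sum_comm

end IsDualDerivation

end LoopEquation

/-! ### Hermitian matrices with polynomial entries. -/

section GenericWigner

open MvPolynomial

/-- The index set of the real coordinates of a Hermitian matrix. -/
abbrev WignerIndex (N : ℕ) : Type := Fin N ⊕ UpperPair N ⊕ UpperPair N

/-- The Hermitian matrix with generic coordinates. -/
noncomputable def genericHermitian (N : ℕ) :
    Matrix (Fin N) (Fin N) (MvPolynomial (WignerIndex N) ℂ) := fun i j =>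
  if h : i < j then
    C ((Real.sqrt 2 : ℂ)⁻¹) * (X (.inr (.inl ⟨(i, j), h⟩)) + C Complex.I * X (.inr (.inr ⟨(i, j), h⟩)))
  else if h : j < i then
    C ((Real.sqrt 2 : ℂ)⁻¹) * (X (.inr (.inl ⟨(j, i), h⟩)) - C Complex.I * X (.inr (.inr ⟨(j, i), h⟩)))
  else X (.inl i)

/-- The derivation dual to an entry of `genericHermitian`. -/
noncomputable def entryDeriv (N : ℕ) (i j : Fin N) :
    Derivation ℂ (MvPolynomial (WignerIndex N) ℂ) (MvPolynomial (WignerIndex N) ℂ) :=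
  if h : i < j then
    (Real.sqrt 2 : ℂ)⁻¹ • (pderiv (.inr (.inl ⟨(i, j), h⟩)) +
      Complex.I • pderiv (.inr (.inr ⟨(i, j), h⟩)))
  else if h : j < i then
    (Real.sqrt 2 : ℂ)⁻¹ • (pderiv (.inr (.inl ⟨(j, i), h⟩)) -
      Complex.I • pderiv (.inr (.inr ⟨(j, i), h⟩)))
  else pderiv (.inl i)

/-- Off the diagonal these are rescaled Wirtinger derivatives: the two real coordinates contribute
1/2 + 1/2 on the transposed entry and 1/2 - 1/2 on the entry itself. -/
theorem isDualDerivation_entryDeriv (N : ℕ) :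
    IsDualDerivation (genericHermitian N) (entryDeriv N) := by
  have h2 : ((Real.sqrt 2 : ℂ)⁻¹) * ((Real.sqrt 2 : ℂ)⁻¹) = 2⁻¹ := by
    rw [← mul_inv, ← Complex.ofReal_mul, Real.mul_self_sqrt (by norm_num)]
    norm_num
  have hI : (C Complex.I * C Complex.I : MvPolynomial (WignerIndex N) ℂ) = -1 := by
    rw [← C_mul, Complex.I_mul_I, C_neg, C_1]
  have hC : (C (Real.sqrt 2 : ℂ)⁻¹ * C (Real.sqrt 2 : ℂ)⁻¹ : MvPolynomial (WignerIndex N) ℂ) * 2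
      = 1 := by
    rw [← C_mul, h2, ← map_ofNat C 2, ← C_mul, inv_mul_cancel₀ two_ne_zero, C_1]
  intro i j l m
  unfold genericHermitian entryDeriv
  rcases lt_trichotomy i j with hij | rfl | hij <;> rcases lt_trichotomy l m with hlm | rfl | hlm
  · by_cases h : i = l ∧ j = m
    · obtain ⟨rfl, rfl⟩ := h
      simp [hij, hij.ne, pderiv_X, MvPolynomial.smul_eq_C_mul]
      linear_combination C (Real.sqrt 2 : ℂ)⁻¹ * hI
    · have h' : ¬ (i = m ∧ j = l) := by rintro ⟨rfl, rfl⟩; exact absurd hij hlm.not_gt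
      simp [hij, hlm, pderiv_X, h', eq_comm, h]
  · have h' : ¬ (i = l ∧ j = l) := by rintro ⟨rfl, rfl⟩; exact lt_irrefl _ hij
    simp [hij, pderiv_X, h']
  · by_cases h : i = m ∧ j = l
    · obtain ⟨rfl, rfl⟩ := h
      simp [hij, hij.not_gt, pderiv_X, MvPolynomial.smul_eq_C_mul]
      linear_combination hC - (C (Real.sqrt 2 : ℂ)⁻¹ * C (Real.sqrt 2 : ℂ)⁻¹) * hI
    · simp [hij, hlm, hlm.not_gt, pderiv_X, eq_comm, h]
  · have h' : ¬ (i = m ∧ i = l) := by rintro ⟨rfl, rfl⟩; exact lt_irrefl _ hlm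
    simp [hlm, pderiv_X, h']
  · simp [pderiv_X, Pi.single_apply, eq_comm]
  · have h' : ¬ (i = m ∧ i = l) := by rintro ⟨rfl, rfl⟩; exact lt_irrefl _ hlm
    simp [hlm, hlm.not_gt, pderiv_X, h']
  · by_cases h : i = m ∧ j = l
    · obtain ⟨rfl, rfl⟩ := h
      simp [hij, hij.not_gt, pderiv_X, MvPolynomial.smul_eq_C_mul]
      linear_combination hC - (C (Real.sqrt 2 : ℂ)⁻¹ * C (Real.sqrt 2 : ℂ)⁻¹) * hI
    · have h' : ¬ (j = l ∧ i = m) := fun e => h e.symm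
      simp [hij, hij.not_gt, hlm, pderiv_X, eq_comm, h,
        h']
  · have h' : ¬ (i = l ∧ j = l) := by rintro ⟨rfl, rfl⟩; exact lt_irrefl _ hij
    simp [hij, hij.not_gt, pderiv_X, h']
  · by_cases h : i = l ∧ j = m
    · obtain ⟨rfl, rfl⟩ := h
      simp [hij, hij.ne', hij.not_gt, pderiv_X, MvPolynomial.smul_eq_C_mul]
      linear_combination C (Real.sqrt 2 : ℂ)⁻¹ * hI
    · have h' : ¬ (i = m ∧ j = l) := by rintro ⟨rfl, rfl⟩; exact absurd hij hlm.not_gt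
      have h'' : ¬ (j = m ∧ i = l) := fun e => h e.symm
      simp [hij, hij.not_gt, hlm, hlm.not_gt, pderiv_X, h', eq_comm, h'']

theorem eval_genericHermitian {N : ℕ} {A : Matrix (Fin N) (Fin N) ℂ} (hA : A.IsHermitian)
    (i j : Fin N) :
    eval (fun k => (wignerCoord A k : ℂ)) (genericHermitian N i j) = A i j := by
  have h2 : ((Real.sqrt 2 : ℝ) : ℂ) ≠ 0 := by simp
  unfold genericHermitian
  rcases lt_trichotomy i j with hij | rfl | hij
  · rw [dif_pos hij]
    simp only [map_mul, map_add, eval_C, eval_X, wignerCoord]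
    push_cast
    rw [show ((Real.sqrt 2 : ℂ)⁻¹) * ((Real.sqrt 2 : ℂ) * ((A i j).re : ℂ) +
      Complex.I * ((Real.sqrt 2 : ℂ) * ((A i j).im : ℂ))) =
      ((A i j).re : ℂ) + ((A i j).im : ℂ) * Complex.I by field_simp]
    exact Complex.re_add_im _
  · rw [dif_neg (lt_irrefl i), dif_neg (lt_irrefl i)]
    simp only [eval_X, wignerCoord]
    exact hA.coe_re_apply_self i
  · rw [dif_neg hij.not_gt, dif_pos hij]
    simp only [map_mul, map_sub, eval_C, eval_X, wignerCoord]
    push_cast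
    rw [show ((Real.sqrt 2 : ℂ)⁻¹) * ((Real.sqrt 2 : ℂ) * ((A j i).re : ℂ) -
      Complex.I * ((Real.sqrt 2 : ℂ) * ((A j i).im : ℂ))) =
      ((A j i).re : ℂ) - ((A j i).im : ℂ) * Complex.I by field_simp]
    rw [← hA.apply i j]
    apply Complex.ext <;> simp

end GenericWigner

/-! ### Loop equations and variance of traces for Wigner matrices. -/

namespace IsComplexWigner

open MvPolynomial

variable {Ω : Type*} [MeasurableSpace Ω] {P : Measure Ω} {N : ℕ}
  {X : Ω → Matrix (Fin N) (Fin N) ℂ} (hX : IsComplexWigner P X)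

/-- The expectation of a polynomial in the real coordinates. -/
noncomputable def expect : MvPolynomial (WignerIndex N) ℂ →ₗ[ℂ] ℂ where
  toFun f := ∫ ω, eval (fun k => (wignerCoord (X ω) k : ℂ)) f ∂P
  map_add' f g := by
    simp only [map_add]
    exact integral_add (hX.indep.integrable_eval_of_gaussian hX.hasLaw f)
      (hX.indep.integrable_eval_of_gaussian hX.hasLaw g)
  map_smul' c f := by
    simp only [smul_eval, RingHom.id_apply, smul_eq_mul]
    exact integral_const_mul _ _

theorem expect_X_mul (k : WignerIndex N) (f : MvPolynomial (WignerIndex N) ℂ) :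
    hX.expect (MvPolynomial.X k * f) = hX.expect (pderiv k f) :=
  hX.indep.integral_eval_X_mul_of_gaussian hX.hasLaw k f

theorem expect_C_mul (c : ℂ) (f : MvPolynomial (WignerIndex N) ℂ) :
    hX.expect (C c * f) = c * hX.expect f := by
  rw [← smul_eq_C_mul, map_smul, smul_eq_mul]

/-- The entry is a linear form in the Gaussian coordinates, and `entryDeriv` carries the same
coefficients on the matching partial derivatives. -/
theorem expect_genericHermitian_mul (i j : Fin N) (f : MvPolynomial (WignerIndex N) ℂ) :
    hX.expect (genericHermitian N i j * f) = hX.expect (entryDeriv N i j f) := by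
  unfold genericHermitian entryDeriv
  rcases lt_trichotomy i j with hij | rfl | hij
  · simp only [dif_pos hij, mul_assoc, add_mul, expect_C_mul, map_add, expect_X_mul,
      Derivation.smul_apply, Derivation.add_apply, map_smul, smul_eq_mul]
  · simp only [lt_irrefl, dite_false, expect_X_mul]
  · simp only [dif_neg hij.not_gt, dif_pos hij, mul_assoc, sub_mul, expect_C_mul, map_sub,
      expect_X_mul, Derivation.smul_apply, Derivation.sub_apply, map_smul, smul_eq_mul]

/-- Expand Tr A^(a+1) as Σ A_ij (A^a)_ji, integrate by parts in A_ij, and recognize the divergence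
of A^a times the trace polynomial. -/
theorem expect_trace_pow_succ_mul (a : ℕ) (G : TracePoly) :
    hX.expect ((genericHermitian N ^ (a + 1)).trace *
        aeval (fun k => (genericHermitian N ^ k).trace) G) =
      hX.expect (aeval (fun k => (genericHermitian N ^ k).trace) (TracePoly.split a * G)) +
        hX.expect (aeval (fun k => (genericHermitian N ^ k).trace) (TracePoly.powDeriv a G)) := by
  have h := (isDualDerivation_entryDeriv N).sum_apply_pow_mul_aeval a G
  rw [← map_add]
  refine Eq.trans ?_ (congrArg hX.expect h)
  rw [pow_succ', Matrix.trace, Finset.sum_mul, map_sum, map_sum]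
  refine Finset.sum_congr rfl fun i _ => ?_
  rw [Matrix.diag_apply, Matrix.mul_apply, Finset.sum_mul, map_sum, map_sum]
  refine Finset.sum_congr rfl fun j _ => ?_
  rw [mul_assoc, expect_genericHermitian_mul]
  rfl

/-- The expectation of a polynomial in the traces of powers. -/
noncomputable def traceFunctional : TracePoly →+ ℝ :=
  Complex.reAddGroupHom.comp (hX.expect.toAddMonoidHom.comp
    (aeval fun k => (genericHermitian N ^ k).trace :
      TracePoly →ₐ[ℕ] MvPolynomial (WignerIndex N) ℂ).toRingHom.toAddMonoidHom)

theorem traceFunctional_apply (G : TracePoly) : hX.traceFunctional G =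
    (hX.expect (aeval (fun k => (genericHermitian N ^ k).trace) G)).re := rfl

theorem isLoopFunctional [IsProbabilityMeasure P] :
    TracePoly.IsLoopFunctional N hX.traceFunctional where
  map_one := by
    rw [traceFunctional_apply, map_one]
    simp [expect]
  map_X_zero_mul F := by
    rw [traceFunctional_apply, traceFunctional_apply, map_mul, aeval_X, pow_zero, Matrix.trace_one,
      Fintype.card_fin, ← map_natCast C, expect_C_mul]
    simp
  map_X_succ_mul a F := by
    rw [traceFunctional_apply, traceFunctional_apply, traceFunctional_apply, map_mul, aeval_X,
      expect_trace_pow_succ_mul, Complex.add_re]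

include hX

theorem trace_pow_eq_ofReal (ω : Ω) (k : ℕ) :
    (X ω ^ k).trace = ((X ω ^ k).trace.re : ℂ) := by
  have h := ((hX.isHermitian ω).pow k)
  have h' : star (X ω ^ k).trace = (X ω ^ k).trace := by
    rw [← Matrix.trace_conjTranspose, h.eq]
  exact (Complex.conj_eq_iff_re.mp h').symm

theorem eval_aeval_trace (ω : Ω) (G : TracePoly) :
    eval (fun k => (wignerCoord (X ω) k : ℂ)) (aeval (fun k => (genericHermitian N ^ k).trace) G) =
      ((aeval (fun k => (X ω ^ k).trace.re) G : ℝ) : ℂ) := by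
  have htr (k : ℕ) : eval (fun k => (wignerCoord (X ω) k : ℂ)) (genericHermitian N ^ k).trace =
      ((X ω ^ k).trace.re : ℂ) := by
    have hm : (eval fun k => (wignerCoord (X ω) k : ℂ)).mapMatrix (genericHermitian N) = X ω := by
      ext i j
      exact eval_genericHermitian (hX.isHermitian ω) i j
    rw [← hX.trace_pow_eq_ofReal]
    calc _ = ((eval fun k => (wignerCoord (X ω) k : ℂ)).mapMatrix
          (genericHermitian N ^ k)).trace := map_sum _ _ _
      _ = _ := by rw [map_pow, hm]
  induction G using MvPolynomial.induction_on with
  | C c => simp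
  | add p q hp hq => simp only [map_add, hp, hq, Complex.ofReal_add]
  | mul_X p k hp => rw [map_mul, map_mul, hp, map_mul, aeval_X, aeval_X, htr, Complex.ofReal_mul]

theorem integrable_aeval_trace (G : TracePoly) :
    Integrable (fun ω => aeval (fun k => (X ω ^ k).trace.re) G) P := by
  have h := (hX.indep.integrable_eval_of_gaussian hX.hasLaw
    (aeval (fun k => (genericHermitian N ^ k).trace) G)).re
  simpa only [hX.eval_aeval_trace, RCLike.re_eq_complex_re, Complex.ofReal_re] using h

theorem traceFunctional_eq_integral (G : TracePoly) :
    hX.traceFunctional G = ∫ ω, aeval (fun k => (X ω ^ k).trace.re) G ∂P := by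
  rw [traceFunctional_apply, expect, LinearMap.coe_mk, AddHom.coe_mk]
  simp only [hX.eval_aeval_trace]
  rw [integral_complex_ofReal, Complex.ofReal_re]

theorem integrable_trace_pow (k : ℕ) : Integrable (fun ω => (X ω ^ k).trace.re) P := by
  simpa using hX.integrable_aeval_trace (MvPolynomial.X k)

theorem integral_trace_pow (k : ℕ) :
    ∫ ω, (X ω ^ k).trace.re ∂P = hX.traceFunctional (MvPolynomial.X k) := by
  rw [hX.traceFunctional_eq_integral]
  simp

theorem integrable_trace_pow_sub_sq [IsProbabilityMeasure P] (k : ℕ) (c : ℝ) :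
    Integrable (fun ω => ((X ω ^ k).trace.re - c) ^ 2) P := by
  have h₂ := hX.integrable_aeval_trace (MvPolynomial.X k * MvPolynomial.X k)
  simp only [map_mul, aeval_X] at h₂
  refine ((h₂.sub ((hX.integrable_trace_pow k).const_mul (2 * c))).add
    (integrable_const (c ^ 2))).congr (ae_of_all _ fun ω => ?_)
  simp only [Pi.add_apply, Pi.sub_apply]
  ring

/-- This is the covariance bound with both factors equal. After division by N^(k+2) it is O(N^-2),
hence summable. -/
theorem integral_trace_pow_sub_sq_le [IsProbabilityMeasure P] (k : ℕ) :
    ∫ ω, ((X ω ^ k).trace.re - hX.traceFunctional (MvPolynomial.X k)) ^ 2 ∂P ≤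
      (k : ℝ) ^ 2 * hX.traceFunctional (MvPolynomial.X (2 * (k - 1))) := by
  set c := hX.traceFunctional (MvPolynomial.X k)
  have h₂ := hX.integrable_aeval_trace (MvPolynomial.X k * MvPolynomial.X k)
  have h₂' := hX.traceFunctional_eq_integral (MvPolynomial.X k * MvPolynomial.X k)
  simp only [map_mul, aeval_X] at h₂ h₂'
  have h₁ := hX.integrable_trace_pow k
  have hcov := hX.isLoopFunctional.map_X_mul_X_le' k k
  rw [show k + k - 2 = 2 * (k - 1) by omega] at hcov
  have : ∫ ω, ((X ω ^ k).trace.re - c) ^ 2 ∂P =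
      hX.traceFunctional (MvPolynomial.X k * MvPolynomial.X k) - c * c := by
    calc _ = ∫ ω, (((X ω ^ k).trace.re * (X ω ^ k).trace.re + -(2 * c) * (X ω ^ k).trace.re) +
          c ^ 2) ∂P := by
          refine integral_congr_ae (ae_of_all _ fun ω => ?_)
          ring
      _ = _ := by
          rw [integral_add (by exact h₂.add (h₁.const_mul _)) (integrable_const _),
            integral_add h₂ (h₁.const_mul _), integral_const_mul, hX.integral_trace_pow, ← h₂']
          simp
          ring
  rw [this]
  linarith

end IsComplexWigner

/-! ### From moments to extreme eigenvalues. -/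

/-- A nonnegative sequence with summable expectations tends to zero almost surely. -/
theorem MeasureTheory.ae_tendsto_zero_of_summable_integral {Ω : Type*} [MeasurableSpace Ω]
    {P : Measure Ω} {Z : ℕ → Ω → ℝ} {b : ℕ → ℝ} (hZ : ∀ n, 1 ≤ n → 0 ≤ Z n)
    (hint : ∀ n, 1 ≤ n → Integrable (Z n) P)
    (hb : ∀ᶠ n in atTop, ∫ ω, Z n ω ∂P ≤ b n) (hs : Summable b) :
    ∀ᵐ ω ∂P, Tendsto (fun n => Z n ω) atTop (𝓝 0) := by
  obtain ⟨m, hm⟩ := (hb.and (eventually_ge_atTop 1)).exists_forall_of_atTop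
  have hs' : Summable fun n => b (n + m) := (summable_nat_add_iff m).mpr hs
  have hlt : ∑' n, ∫⁻ ω, ENNReal.ofReal (Z (n + m) ω) ∂P ≠ ⊤ := by
    refine ne_top_of_le_ne_top (b := ∑' n, ENNReal.ofReal (b (n + m))) ?_ ?_
    · exact hs'.tsum_ofReal_ne_top
    · refine ENNReal.tsum_le_tsum fun n => ?_
      have h := hm (n + m) (by omega)
      rw [← ofReal_integral_eq_lintegral_ofReal (hint _ h.2) (ae_of_all _ (hZ _ h.2))]
      exact ENNReal.ofReal_le_ofReal h.1
  have hmeas : ∀ n, AEMeasurable (fun ω => ENNReal.ofReal (Z (n + m) ω)) P := fun n =>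
    (hint _ (hm (n + m) (by omega)).2).aemeasurable.ennreal_ofReal
  rw [← lintegral_tsum hmeas] at hlt
  filter_upwards [ae_lt_top' (AEMeasurable.tsum hmeas) hlt] with ω hω
  rw [← tendsto_add_atTop_iff_nat m]
  have h := ENNReal.tendsto_atTop_zero_of_tsum_ne_top hω.ne
  have h' := (ENNReal.tendsto_toReal ENNReal.zero_ne_top).comp h
  refine h'.congr fun n => ?_
  exact ENNReal.toReal_ofReal (hZ _ (hm (n + m) (by omega)).2 ω)

/-- The moments of the semicircle law. -/
def semicircleMoment (k : ℕ) : ℝ := if Even k then (catalan (k / 2) : ℝ) else 0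

theorem semicircleMoment_nonneg (k : ℕ) : 0 ≤ semicircleMoment k := by
  unfold semicircleMoment
  split_ifs <;> positivity

theorem semicircleMoment_two_mul (k : ℕ) : semicircleMoment (2 * k) = catalan k := by
  simp [semicircleMoment]

theorem neg_one_pow_mul_semicircleMoment (k : ℕ) :
    (-1) ^ k * semicircleMoment k = semicircleMoment k := by
  unfold semicircleMoment
  split_ifs with h
  · rw [h.neg_one_pow, one_mul]
  · rw [mul_zero]

theorem Nat.four_pow_le_mul_centralBinom (n : ℕ) : 4 ^ n ≤ (2 * n + 1) * n.centralBinom := by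
  rcases n.eq_zero_or_pos with rfl | hn
  · simp
  · exact (Nat.four_pow_le_two_mul_self_mul_centralBinom n hn).trans
      (Nat.mul_le_mul_right _ (by omega))

/-- The shifted semicircle moments grow like the powers of `4`. -/
theorem exists_pow_lt_shifted_semicircleMoment {x : ℝ} (hx0 : 0 ≤ x) (hx : x < 4) :
    ∃ n : ℕ, x ^ (2 * n) <
      ∑ k ∈ Finset.range (2 * n + 1), semicircleMoment k * 2 ^ (2 * n - k) * (2 * n).choose k := by
  -- The sum is the moment of order 2n of the semicircle law shifted by 2. With n = 2r its middle
  -- term alone is at least 4^(4r) / (30 r^3); the constant is 5 · 3 · 2, from bounding 4r+1, 2r+1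
  -- and r+1 by multiples of r.
  have hlim := tendsto_pow_const_mul_const_pow_of_abs_lt_one 3 (r := (x / 4) ^ 4) (by
    rw [abs_of_nonneg (by positivity)]
    exact pow_lt_one₀ (by positivity) (by linarith) (by norm_num))
  obtain ⟨r, hr, hr1⟩ :=
    ((hlim.eventually (gt_mem_nhds (show (0 : ℝ) < 1 / 30 by norm_num))).and
      (eventually_ge_atTop 1)).exists
  refine ⟨2 * r, ?_⟩
  refine lt_of_lt_of_le ?_ (Finset.single_le_sum (f := fun k =>
    semicircleMoment k * 2 ^ (2 * (2 * r) - k) * ((2 * (2 * r)).choose k : ℝ))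
    (fun k _ => by have := semicircleMoment_nonneg k; positivity)
    (show 2 * r ∈ Finset.range (2 * (2 * r) + 1) by rw [Finset.mem_range]; omega))
  have h₁ : (4 : ℝ) ^ (2 * r) ≤ (2 * (2 * r) + 1) * ((2 * r).centralBinom : ℝ) := by
    exact_mod_cast Nat.four_pow_le_mul_centralBinom (2 * r)
  have h₂ : (4 : ℝ) ^ r ≤ (2 * r + 1) * ((r + 1) * (catalan r : ℝ)) := by
    have := Nat.four_pow_le_mul_centralBinom r
    rw [← succ_mul_catalan_eq_centralBinom] at this
    exact_mod_cast this
  have hr' : (1 : ℝ) ≤ r := by exact_mod_cast hr1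
  rw [semicircleMoment_two_mul, ← Nat.centralBinom_eq_two_mul_choose,
    show 2 * (2 * r) - 2 * r = 2 * r by omega]
  have hprod : (4 : ℝ) ^ (4 * r) ≤ 30 * r ^ 3 *
      ((catalan r : ℝ) * 2 ^ (2 * r) * ((2 * r).centralBinom : ℝ)) := by
    calc (4 : ℝ) ^ (4 * r) = 4 ^ (2 * r) * 2 ^ (2 * r) * 4 ^ r := by
          rw [pow_mul (2 : ℝ) 2 r, show (2 : ℝ) ^ 2 = 4 by norm_num, ← pow_add, ← pow_add]
          congr 1
          ring
      _ ≤ ((2 * (2 * r) + 1) * ((2 * r).centralBinom : ℝ)) * 2 ^ (2 * r) *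
          ((2 * r + 1) * ((r + 1) * (catalan r : ℝ))) := by gcongr
      _ ≤ ((5 * r) * ((2 * r).centralBinom : ℝ)) * 2 ^ (2 * r) *
          ((3 * r) * ((2 * r) * (catalan r : ℝ))) := by gcongr <;> linarith
      _ = _ := by ring
  have hx4 : x ^ (2 * (2 * r)) = ((x / 4) ^ 4) ^ r * 4 ^ (4 * r) := by
    rw [← pow_mul, ← mul_pow, div_mul_cancel₀ _ (by norm_num)]
    congr 1
    ring
  have hpos : 0 < (catalan r : ℝ) * 2 ^ (2 * r) * ((2 * r).centralBinom : ℝ) := by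
    by_contra h
    have h' : 30 * (r : ℝ) ^ 3 * ((catalan r : ℝ) * 2 ^ (2 * r) * ((2 * r).centralBinom : ℝ)) ≤ 0 :=
      mul_nonpos_of_nonneg_of_nonpos (by positivity) (not_lt.mp h)
    have : (0 : ℝ) < 4 ^ (4 * r) := by positivity
    linarith
  rw [hx4]
  calc ((x / 4) ^ 4) ^ r * 4 ^ (4 * r) ≤ ((x / 4) ^ 4) ^ r * (30 * r ^ 3 *
      ((catalan r : ℝ) * 2 ^ (2 * r) * ((2 * r).centralBinom : ℝ))) := by gcongr
    _ = 30 * (r ^ 3 * ((x / 4) ^ 4) ^ r) *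
      ((catalan r : ℝ) * 2 ^ (2 * r) * ((2 * r).centralBinom : ℝ)) := by ring
    _ < 1 * ((catalan r : ℝ) * 2 ^ (2 * r) * ((2 * r).centralBinom : ℝ)) := by
      refine mul_lt_mul_of_pos_right ?_ hpos
      linarith
    _ = _ := one_mul _

section EmpiricalMoments

variable {l : (N : ℕ) → Fin N → ℝ}

/-- If the empirical moments converge to those of the semicircle law and the points are
asymptotically in `[-2, 2]`, some point is eventually close to `2`. -/
theorem eventually_exists_gt_of_tendsto_semicircleMoment
    (hmom : ∀ k, Tendsto (fun N => (∑ i, l N i ^ k) / (N : ℝ)) atTop (𝓝 (semicircleMoment k)))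
    (hbd : ∀ ε > 0, ∀ᶠ N in atTop, ∀ i, |l N i| ≤ 2 + ε) {ε : ℝ} (hε : 0 < ε) (hε2 : ε < 2) :
    ∀ᶠ N in atTop, ∃ i, 2 - ε < l N i := by
  obtain ⟨n, hn⟩ := exists_pow_lt_shifted_semicircleMoment (x := 4 - ε) (by linarith) (by linarith)
  have hlim : Tendsto (fun N => (∑ i, (l N i + 2) ^ (2 * n)) / (N : ℝ)) atTop
      (𝓝 (∑ k ∈ Finset.range (2 * n + 1),
        semicircleMoment k * 2 ^ (2 * n - k) * (2 * n).choose k)) := by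
    have h := tendsto_finsetSum (Finset.range (2 * n + 1)) fun k _ =>
      ((hmom k).mul_const (2 ^ (2 * n - k))).mul_const (((2 * n).choose k : ℕ) : ℝ)
    refine h.congr fun N => ?_
    simp_rw [add_pow]
    rw [Finset.sum_comm, Finset.sum_div]
    refine Finset.sum_congr rfl fun k _ => ?_
    rw [← Finset.sum_mul, ← Finset.sum_mul]
    ring
  filter_upwards [hlim.eventually (lt_mem_nhds hn), hbd ε hε, eventually_ge_atTop 1]
    with N h₁ h₂ hN
  by_contra! h
  have hN' : (0 : ℝ) < N := by exact_mod_cast hN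
  rw [lt_div_iff₀ hN'] at h₁
  have : ∑ i, (l N i + 2) ^ (2 * n) ≤ ∑ _i : Fin N, (4 - ε) ^ (2 * n) := by
    refine Finset.sum_le_sum fun i _ => ?_
    -- The shifted points lie in [-ε, 4 - ε], and ε < 2 makes 4 - ε the bound for their modulus.
    rw [pow_mul, pow_mul]
    refine pow_le_pow_left₀ (sq_nonneg _) ?_ n
    have := abs_le.mp (h₂ i)
    exact sq_le_sq' (by linarith) (by linarith [h i])
  rw [Finset.sum_const, Finset.card_univ, Fintype.card_fin, nsmul_eq_mul] at this
  linarith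

end EmpiricalMoments

theorem Matrix.IsHermitian.trace_pow_re {N : ℕ} {A : Matrix (Fin N) (Fin N) ℂ}
    (hA : A.IsHermitian) (k : ℕ) : (A ^ k).trace.re = ∑ i, hA.eigenvalues i ^ k := by
  have h := congrArg (fun B => (B ^ k).trace.re) hA.spectral_theorem
  rw [h, ← map_pow, Matrix.diagonal_pow, Unitary.conjStarAlgAut_apply, Matrix.trace_mul_cycle]
  simp [Matrix.trace_diagonal, ← Complex.ofReal_pow]

/-- Convergence of the extreme eigenvalues of Hermitian matrices from the convergence of the
moments and an asymptotic bound. -/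
theorem tendsto_lambdaMax_lambdaMin {A : (N : ℕ) → Matrix (Fin N) (Fin N) ℂ}
    (hA : ∀ N, (A N).IsHermitian)
    (hmom : ∀ k, Tendsto (fun N => (A N ^ k).trace.re / (N : ℝ)) atTop (𝓝 (semicircleMoment k)))
    (hbd : ∀ ε > 0, ∀ᶠ N in atTop, ∀ i, |(hA N).eigenvalues i| ≤ 2 + ε) :
    Tendsto (fun N => lambdaMax (A N)) atTop (𝓝 2) ∧
      Tendsto (fun N => lambdaMin (A N)) atTop (𝓝 (-2)) := by
  simp_rw [fun N => (hA N).trace_pow_re] at hmom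
  -- The semicircle moments are symmetric, so the lower edge follows from the upper edge applied to
  -- the negated eigenvalues.
  have hmom' : ∀ k, Tendsto (fun N => (∑ i, (-(hA N).eigenvalues i) ^ k) / (N : ℝ)) atTop
      (𝓝 (semicircleMoment k)) := by
    intro k
    have h := (hmom k).const_mul ((-1) ^ k)
    rw [neg_one_pow_mul_semicircleMoment] at h
    refine h.congr fun N => ?_
    rw [← mul_div_assoc, Finset.mul_sum]
    congr 1
    exact Finset.sum_congr rfl fun i _ => (neg_pow _ _).symm
  have hbd' : ∀ ε > 0, ∀ᶠ N in atTop, ∀ i, |(-(hA N).eigenvalues i)| ≤ 2 + ε := by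
    simpa only [abs_neg] using hbd
  constructor
  · rw [Metric.tendsto_nhds]
    intro ε hε
    filter_upwards [eventually_exists_gt_of_tendsto_semicircleMoment hmom hbd
      (ε := min ε 1) (by positivity) (by linarith [min_le_right ε 1]), hbd (ε / 2) (by positivity),
      eventually_ge_atTop 1] with N h₁ h₂ hN
    have hmax := lambdaMax_isGreatest hN (hA N)
    rw [realEigenvalues_eq_range (hA N)] at hmax
    obtain ⟨i, hi⟩ := h₁
    obtain ⟨j, hj⟩ := hmax.1
    have h₃ := hmax.2 ⟨i, rfl⟩
    have h₄ := (abs_le.mp (h₂ j)).2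
    rw [hj] at h₄
    rw [Real.dist_eq, abs_lt]
    constructor <;> linarith [min_le_left ε 1]
  · rw [Metric.tendsto_nhds]
    intro ε hε
    filter_upwards [eventually_exists_gt_of_tendsto_semicircleMoment hmom' hbd'
      (ε := min ε 1) (by positivity) (by linarith [min_le_right ε 1]), hbd (ε / 2) (by positivity),
      eventually_ge_atTop 1] with N h₁ h₂ hN
    have hmin := lambdaMin_isLeast hN (hA N)
    rw [realEigenvalues_eq_range (hA N)] at hmin
    obtain ⟨i, hi⟩ := h₁
    obtain ⟨j, hj⟩ := hmin.1
    have h₃ := hmin.2 ⟨i, rfl⟩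
    have h₄ := (abs_le.mp (h₂ j)).1
    rw [hj] at h₄
    rw [Real.dist_eq, abs_lt]
    constructor <;> linarith [min_le_left ε 1]

/-- With q = ⌊√N⌋, N ≤ 4 q^2 gives N^3 ρ^q ≤ 64 q^6 ρ^q, and q^6 ρ^q tends to zero, so the terms are
O(N^-2). -/
theorem summable_mul_pow_natSqrt {ρ : ℝ} (h0 : 0 ≤ ρ) (h1 : ρ < 1) :
    Summable fun N : ℕ => (N : ℝ) * ρ ^ Nat.sqrt N := by
  have hsqrt : Tendsto Nat.sqrt atTop atTop :=
    tendsto_atTop_mono' atTop (eventually_atTop.mpr ⟨0, fun _ _ => le_rfl⟩)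
      (tendsto_atTop_atTop.mpr fun b => ⟨b * b, fun a ha => Nat.le_sqrt.mpr ha⟩)
  have hlim := (tendsto_pow_const_mul_const_pow_of_abs_lt_one 6
    (by rwa [abs_of_nonneg h0])).comp hsqrt
  have hs : Summable fun N : ℕ => 1 / (N : ℝ) ^ 2 :=
    Real.summable_one_div_nat_pow.mpr one_lt_two
  refine summable_of_isBigO_nat hs (Asymptotics.IsBigO.of_bound 64 ?_)
  filter_upwards [hlim.eventually (gt_mem_nhds zero_lt_one), eventually_ge_atTop 1] with N hN hN1
  have hq : 1 ≤ Nat.sqrt N := Nat.le_sqrt.mpr (by omega)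
  have hle : N ≤ 4 * Nat.sqrt N ^ 2 := by
    have := Nat.lt_succ_sqrt' N
    have h2 : (Nat.sqrt N).succ ^ 2 ≤ (2 * Nat.sqrt N) ^ 2 := Nat.pow_le_pow_left (by omega) 2
    nlinarith
  have hle' : (N : ℝ) ≤ 4 * (Nat.sqrt N : ℝ) ^ 2 := by exact_mod_cast hle
  have hN' : (0 : ℝ) < N := by exact_mod_cast hN1
  rw [Real.norm_of_nonneg (by positivity), Real.norm_of_nonneg (by positivity), mul_one_div,
    le_div_iff₀ (by positivity)]
  simp only [Function.comp_apply] at hN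
  calc (N : ℝ) * ρ ^ Nat.sqrt N * (N : ℝ) ^ 2 = (N : ℝ) ^ 3 * ρ ^ Nat.sqrt N := by ring
    _ ≤ (4 * (Nat.sqrt N : ℝ) ^ 2) ^ 3 * ρ ^ Nat.sqrt N := by gcongr
    _ = 64 * ((Nat.sqrt N : ℝ) ^ 6 * ρ ^ Nat.sqrt N) := by ring
    _ ≤ 64 := by linarith

theorem Matrix.IsHermitian.eigenvalues_pow_le_trace {N : ℕ} {A : Matrix (Fin N) (Fin N) ℂ}
    (hA : A.IsHermitian) (p : ℕ) (i : Fin N) :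
    |hA.eigenvalues i| ^ (2 * p) ≤ (A ^ (2 * p)).trace.re := by
  rw [hA.trace_pow_re, Even.pow_abs (even_two_mul p)]
  exact Finset.single_le_sum (f := fun i => hA.eigenvalues i ^ (2 * p))
    (fun i _ => (even_two_mul p).pow_nonneg _) (Finset.mem_univ i)

theorem Matrix.trace_real_smul_pow_re {N : ℕ} (A : Matrix (Fin N) (Fin N) ℂ) (c : ℝ) (k : ℕ) :
    ((c • A) ^ k).trace.re = c ^ k * (A ^ k).trace.re := by
  rw [smul_pow, Matrix.trace_smul, Complex.smul_re, smul_eq_mul]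

/-! ### Almost sure convergence of moments and confinement of the spectrum. -/

section ComplexWignerSequence

open TracePoly.IsLoopFunctional

variable {Ω : Type*} [MeasurableSpace Ω] {P : Measure Ω} [IsProbabilityMeasure P]
  {M : (N : ℕ) → Ω → Matrix (Fin N) (Fin N) ℂ}

/-- The expectations of the polynomials in the traces of powers, along a sequence. -/
noncomputable def traceFunctionalSeq (hM : ∀ N : ℕ, 1 ≤ N → IsComplexWigner P (M N)) (N : ℕ) :
    TracePoly →+ ℝ :=
  if h : 1 ≤ N then (hM N h).traceFunctional else 0

variable (hM : ∀ N : ℕ, 1 ≤ N → IsComplexWigner P (M N))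

omit [IsProbabilityMeasure P] in
theorem traceFunctionalSeq_of_le {N : ℕ} (h : 1 ≤ N) :
    traceFunctionalSeq hM N = (hM N h).traceFunctional := dif_pos h

theorem isLoopFunctional_traceFunctionalSeq (N : ℕ) (h : 1 ≤ N) :
    TracePoly.IsLoopFunctional N (traceFunctionalSeq hM N) := by
  rw [traceFunctionalSeq_of_le hM h]
  exact (hM N h).isLoopFunctional

theorem tendsto_traceFunctionalSeq_X (k : ℕ) :
    Tendsto (fun N : ℕ => (1 / Real.sqrt N) ^ k * traceFunctionalSeq hM N (MvPolynomial.X k) / N)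
      atTop (𝓝 (semicircleMoment k)) := by
  rcases Nat.even_or_odd k with hk | hk
  · obtain ⟨p, rfl⟩ := hk.two_dvd
    rw [semicircleMoment_two_mul]
    refine (tendsto_evenMoment (isLoopFunctional_traceFunctionalSeq hM) p).congr fun N => ?_
    rw [evenMoment, pow_mul, div_pow, Real.sq_sqrt (Nat.cast_nonneg N), one_pow, div_pow, one_pow,
      one_div_mul_eq_div, div_div, pow_succ]
  · rw [semicircleMoment, if_neg (Nat.not_even_iff_odd.mpr hk)]
    refine tendsto_const_nhds.congr' ?_
    filter_upwards [eventually_ge_atTop 1] with N hN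
    rw [(isLoopFunctional_traceFunctionalSeq hM N hN).map_X_odd k hk, mul_zero, zero_div]

include hM

theorem ae_tendsto_trace_pow (k : ℕ) : ∀ᵐ ω ∂P,
    Tendsto (fun N : ℕ => (((1 / Real.sqrt (N : ℝ)) • M N ω) ^ k).trace.re / (N : ℝ)) atTop
      (𝓝 (semicircleMoment k)) := by
  set T := traceFunctionalSeq hM with hTdef
  set c : ℕ → ℝ := fun N => (1 / Real.sqrt N) ^ k / N with hc
  have hbound : ∀ᶠ N in atTop, evenMoment N (T N) (k - 1) ≤ catalan (k - 1) + 1 :=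
    ((tendsto_evenMoment (isLoopFunctional_traceFunctionalSeq hM) (k - 1)).eventually
      (gt_mem_nhds (lt_add_one _))).mono fun _ h => h.le
  have hsum : Summable fun N : ℕ => (k : ℝ) ^ 2 * (catalan (k - 1) + 1) * (1 / (N : ℝ) ^ 2) :=
    (Real.summable_one_div_nat_pow.mpr one_lt_two).mul_left _
  have hae := ae_tendsto_zero_of_summable_integral (P := P)
    (Z := fun N ω => c N ^ 2 * ((M N ω ^ k).trace.re - T N (MvPolynomial.X k)) ^ 2)
    (fun N hN ω => by simp only [Pi.zero_apply]; positivity)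
    (fun N hN => ((hM N hN).integrable_trace_pow_sub_sq k _).const_mul _)
    (by
      filter_upwards [hbound, eventually_ge_atTop 1] with N hN hN1
      have hN' : (0 : ℝ) < N := by exact_mod_cast hN1
      rw [integral_const_mul, hTdef, traceFunctionalSeq_of_le hM hN1]
      rw [hTdef, traceFunctionalSeq_of_le hM hN1] at hN
      refine (mul_le_mul_of_nonneg_left ((hM N hN1).integral_trace_pow_sub_sq_le k)
        (sq_nonneg _)).trans ?_
      rcases Nat.eq_zero_or_pos k with rfl | hk
      · simp
      have hc2 : c N ^ 2 = 1 / ((N : ℝ) ^ 2 * N ^ k) := by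
        rw [hc]
        simp only
        rw [div_pow, ← pow_mul, mul_comm k 2, pow_mul, div_pow, Real.sq_sqrt hN'.le, one_pow,
          div_pow, one_pow, div_div, mul_comm]
      rw [hc2]
      calc 1 / ((N : ℝ) ^ 2 * N ^ k) * ((k : ℝ) ^ 2 *
            (hM N hN1).traceFunctional (MvPolynomial.X (2 * (k - 1)))) =
          (k : ℝ) ^ 2 * evenMoment N (hM N hN1).traceFunctional (k - 1) * (1 / (N : ℝ) ^ 2) := by
            rw [evenMoment, Nat.sub_add_cancel hk]
            field_simp
        _ ≤ _ := by gcongr)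
    hsum
  filter_upwards [hae] with ω hω
  have h₁ : Tendsto (fun N => c N * ((M N ω ^ k).trace.re - T N (MvPolynomial.X k))) atTop
      (𝓝 0) := by
    have h := hω.sqrt
    rw [Real.sqrt_zero] at h
    refine tendsto_zero_iff_abs_tendsto_zero _ |>.mpr (h.congr fun N => ?_)
    rw [← mul_pow, Real.sqrt_sq_eq_abs]
    rfl
  have h₂ := h₁.add (tendsto_traceFunctionalSeq_X hM k)
  rw [zero_add] at h₂
  refine h₂.congr fun N => ?_
  rw [Matrix.trace_real_smul_pow_re]
  simp only [hc]
  ring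

theorem ae_eventually_abs_eigenvalues_le
    (hA : ∀ ω (N : ℕ), ((1 / Real.sqrt (N : ℝ)) • M N ω).IsHermitian) {ε : ℝ} (hε : 0 < ε) :
    ∀ᵐ ω ∂P, ∀ᶠ N in atTop, ∀ i, |(hA ω N).eigenvalues i| ≤ 2 + ε := by
  set T := traceFunctionalSeq hM with hTdef
  -- This is the ratio per unit of q = ⌊√N⌋ between the bound 4^q (1 + ε/2)^q on the moment of order
  -- 2q and (2 + ε)^(2q); it is below 1 since (2 + ε)^2 > 4 + 2ε.
  set ρ : ℝ := 4 * (1 + ε / 2) / (2 + ε) ^ 2 with hρ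
  have hρ0 : 0 ≤ ρ := by positivity
  have hρ1 : ρ < 1 := by
    rw [hρ, div_lt_one (by positivity)]
    nlinarith
  -- With q ≤ √N the error (2q + 1) q^2 / N^2 is at most 3 / √N, so `evenMoment_le_of_le` applies
  -- with δ = ε/2.
  have hsmall : ∀ᶠ N : ℕ in atTop,
      (2 * (Nat.sqrt N : ℝ) + 1) * (Nat.sqrt N : ℝ) ^ 2 / (N : ℝ) ^ 2 ≤ ε / 2 := by
    have hlim : Tendsto (fun N : ℕ => 3 / Real.sqrt (N : ℝ)) atTop (𝓝 0) :=
      tendsto_const_nhds.div_atTop (Real.tendsto_sqrt_atTop.comp tendsto_natCast_atTop_atTop)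
    filter_upwards [hlim.eventually (gt_mem_nhds (half_pos hε)), eventually_ge_atTop 1]
      with N hN hN1
    refine le_trans ?_ hN.le
    have hN' : (1 : ℝ) ≤ N := by exact_mod_cast hN1
    set s := Real.sqrt (N : ℝ) with hs
    have hs1 : 1 ≤ s := Real.one_le_sqrt.mpr hN'
    have hsN : (N : ℝ) = s ^ 2 := (Real.sq_sqrt (by positivity)).symm
    have hqs : (Nat.sqrt N : ℝ) ≤ s := Real.nat_sqrt_le_real_sqrt
    rw [div_le_div_iff₀ (by positivity) (by positivity)]
    calc (2 * (Nat.sqrt N : ℝ) + 1) * (Nat.sqrt N : ℝ) ^ 2 * s ≤ (2 * s + s) * s ^ 2 * s := by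
          gcongr
      _ = 3 * (N : ℝ) ^ 2 := by rw [hsN]; ring
  have hae := ae_tendsto_zero_of_summable_integral (P := P)
    (Z := fun N ω => (1 / ((2 + ε) * Real.sqrt N)) ^ (2 * Nat.sqrt N) *
      (M N ω ^ (2 * Nat.sqrt N)).trace.re)
    (fun N hN ω => by
      simp only [Pi.zero_apply]
      refine mul_nonneg (by positivity) ?_
      rw [((hM N hN).isHermitian ω).trace_pow_re]
      exact Finset.sum_nonneg fun i _ => (even_two_mul _).pow_nonneg _)
    (fun N hN => ((hM N hN).integrable_trace_pow _).const_mul _)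
    (b := fun N => (N : ℝ) * ρ ^ Nat.sqrt N)
    (by
      filter_upwards [hsmall, eventually_ge_atTop 1] with N hN hN1
      have hN' : (0 : ℝ) < N := by exact_mod_cast hN1
      have hT := (hM N hN1).isLoopFunctional
      have hm := hT.evenMoment_le_of_le (by omega) hN (Nat.sqrt N) le_rfl
      rw [integral_const_mul, (hM N hN1).integral_trace_pow]
      set q := Nat.sqrt N
      have hcat : ((catalan q : ℕ) : ℝ) ≤ 4 ^ q := by exact_mod_cast Nat.catalan_le_four_pow q
      calc (1 / ((2 + ε) * Real.sqrt N)) ^ (2 * q) *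
            (hM N hN1).traceFunctional (MvPolynomial.X (2 * q)) =
          N * (evenMoment N (hM N hN1).traceFunctional q / ((2 + ε) ^ 2) ^ q) := by
            rw [evenMoment, pow_mul, div_pow, mul_pow, Real.sq_sqrt hN'.le, one_pow, div_pow,
              one_pow, mul_pow, pow_succ]
            field_simp
            ring
        _ ≤ N * (4 ^ q * (1 + ε / 2) ^ q / ((2 + ε) ^ 2) ^ q) := by
            gcongr
            refine hm.trans ?_
            gcongr
        _ = N * ρ ^ q := by rw [hρ, div_pow, mul_pow])
    (summable_mul_pow_natSqrt hρ0 hρ1)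
  filter_upwards [hae] with ω hω
  filter_upwards [hω.eventually (gt_mem_nhds zero_lt_one), eventually_ge_atTop 1] with N hN hN1 i
  have hq : 2 * Nat.sqrt N ≠ 0 := by
    have : 1 ≤ Nat.sqrt N := Nat.le_sqrt.mpr (by omega)
    omega
  -- Once the rescaled trace is below 1, each even power of an eigenvalue, being at most the trace,
  -- is below (2 + ε)^(2q).
  have h := (hA ω N).eigenvalues_pow_le_trace (Nat.sqrt N) i
  rw [Matrix.trace_real_smul_pow_re] at h
  refine (pow_le_pow_iff_left₀ (abs_nonneg _) (by positivity) hq).mp ?_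
  refine h.trans ?_
  rw [one_div, mul_inv, mul_pow, mul_assoc, ← one_div (Real.sqrt N), inv_pow,
    inv_mul_lt_iff₀ (by positivity), mul_one] at hN
  exact hN.le

end ComplexWignerSequence

theorem mainTheorem11 {Ω : Type*} [MeasurableSpace Ω] (P : Measure Ω) [IsProbabilityMeasure P]
    (M : (N : ℕ) → Ω → Matrix (Fin N) (Fin N) ℂ)
    (hM : ∀ N : ℕ, 1 ≤ N → IsComplexWigner P (M N)) :
    ∀ᵐ ω ∂P,
      Tendsto (fun N : ℕ => lambdaMax ((1 / Real.sqrt (N : ℝ)) • M N ω)) atTop (𝓝 2) ∧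
      Tendsto (fun N : ℕ => lambdaMin ((1 / Real.sqrt (N : ℝ)) • M N ω)) atTop (𝓝 (-2)) := by
  have hA : ∀ ω (N : ℕ), ((1 / Real.sqrt (N : ℝ)) • M N ω).IsHermitian := by
    intro ω N
    rcases Nat.eq_zero_or_pos N with rfl | hN
    · exact Matrix.ext fun i => i.elim0
    · exact ((hM N hN).isHermitian ω).smul (IsSelfAdjoint.all _)
  -- Restricting ε to the values 1/(n+1) leaves countably many null sets to discard.
  have hbd : ∀ᵐ ω ∂P, ∀ n : ℕ, ∀ᶠ N in atTop, ∀ i,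
      |(hA ω N).eigenvalues i| ≤ 2 + 1 / ((n : ℝ) + 1) :=
    ae_all_iff.mpr fun n => ae_eventually_abs_eigenvalues_le hM hA Nat.one_div_pos_of_nat
  filter_upwards [ae_all_iff.mpr (ae_tendsto_trace_pow hM), hbd] with ω hmom hω
  refine tendsto_lambdaMax_lambdaMin (hA ω) hmom fun ε hε => ?_
  obtain ⟨n, hn⟩ := exists_nat_one_div_lt hε
  filter_upwards [hω n] with N hN i
  linarith [hN i]
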